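/- Let $\mathcal M=(\mathcal S,\mathcal A,\mathbb P,R,\gamma)$ be a discounted Markov decision process with finite non-empty state and action spaces, $S=|\mathcal S|$, deterministic rewards $0\le R(s,a)\le 1$ and discount factor $0\le\gamma<1$. For a stationary randomised policy $\pi$ let $V^\pi_{\mathcal M}(s)$ be its expected discounted return from $s$, and let $V^*_{\mathcal M}(s)=\sup_\pi V^\pi_{\mathcal M}(s)$. Let $g:\mathcal A\to\mathcal G$ be a surjective grouping function, $|g|=|\mathcal G|$, $\mathcal A_h=g^{-1}(h)$, and for each $h\in\mathcal G$ let $\pi^{\mathsf i}(\cdot|h)$ be a probability distribution on $\mathcal A_h$. Put $$\mathbb P_G(s'|s,h)=\sum_a\pi^{\mathsf i}(a|h)\mathbb P(s'|s,a),\qquad R_G(s,h)=\sum_a\pi^{\mathsf i}(a|h)R(s,a),$$ $$\beta_P^*=1-\min_{s,h}\sum_{s'}\min_{a\in\mathcal A_h}\mathbb P(s'|s,a),\qquad \beta_R^*=\max_{s,\;g(a_1)=g(a_2)}\bigl(R(s,a_1)-R(s,a_2)\bigr).$$ For every pair $(s,h)\in\mathcal S\times\mathcal G$ draw $K'$ next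 states from $\mathbb P_G(\cdot|s,h)$, all draws being independent, each with observed reward $R_G(s,h)$; thus $K=S|g|K'$ samples are used in total. Let $\hat{\mathbb P}_G(s'|s,h)$ be the empirical frequencies and $\hat R_G(s,h)$ the average of the observed rewards. Run value iteration for $T\ge 0$ iterations on the estimated model: $\hat Q^0=0$ and $$\hat Q^{t+1}(s,h)=\hat R_G(s,h)+\gamma\sum_{s'}\hat{\mathbb P}_G(s'|s,h)\max_{h'}\hat Q^t(s',h'),$$ and output $\pi^{\mathsf o}_T(s)\in\arg\max_h\hat Q^T(s,h)$. Let $\pi_{G,T}$ be the policy which at $s$ plays an action drawn from $\pi^{\mathsf i}(\cdot|\pi^{\mathsf o}_T(s))$. Let $0<\delta<1$ and suppose that $$K\ \ge\ \frac{648\,S|g|\log\frac{8S|g|}{\delta(1-\gamma)}}{(1-\gamma)^2}.$$ Then: (1) The value-iteration run takes exactly $(S^2|g|+2S|g|)\,T$ operations, where an operation is a multiplication, a multiply-add $xy+z$, or one step of a running maximum (start it, or compare with it and update it, recording the maximiser), and it outputs a policy $\pi^{\mathsf o}_T$ with $\pi^{\mathsf o}_T(s)\in\arg\max_h\hat Q^T(s,h)$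 for all $s$. (2) With probability larger than $1-\delta$, and however ties in the $\arg\max$ are broken, $$\|V^*_{\mathcal M}-V^{\pi_{G,T}}_{\mathcal M}\|_\infty\le 2\left(\frac{\beta_R^*}{1-\gamma}+\frac{\gamma\beta_P^*}{(1-\gamma)^2}\right)+20\gamma\sqrt{\frac{S|g|\log\left(\frac{8S|g|}{\delta(1-\gamma)}\right)}{K(1-\gamma)^3}}+\frac{8\gamma^T}{(1-\gamma)^3}.$$ -/

import Mathlib

open MeasureTheory ProbabilityTheory

namespace GroupedMDP

noncomputable section

/-- A discounted Markov decision process with finite state space `S` and action space `A`: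
`P s a s'` is the probability of moving to `s'` from `s` under `a`, `R s a` is the
(deterministic) reward and `γ` the discount factor. -/
structure MDP (S A : Type*) [Fintype S] where
  P : S → A → S → ℝ
  P_mem : ∀ s a, P s a ∈ stdSimplex ℝ S
  R : S → A → ℝ
  γ : ℝ
  γ_nonneg : 0 ≤ γ
  γ_lt_one : γ < 1

/-- A stationary randomised policy: a map from states to distributions over actions. -/
abbrev Policy (S A : Type*) [Fintype A] := S → stdSimplex ℝ A

namespace MDP

variable {S A : Type*} [Fintype S] [Fintype A]

/-- Law of `(s_{t+1}, a_{t+1})` given `(s_t, a_t) = z`: the next state is drawn from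
`P (· | z)` and the next action from `π (· | s_{t+1})`. -/
def stepPMF (M : MDP S A) (π : Policy S A) (z : S × A) : PMF (S × A) :=
  PMF.ofFintype (fun z' => ENNReal.ofReal (M.P z.1 z.2 z'.1 * π z'.1 z'.2)) (by
    have h0 : ∀ z' : S × A, 0 ≤ M.P z.1 z.2 z'.1 * π z'.1 z'.2 := fun z' =>
      mul_nonneg ((M.P_mem z.1 z.2).1 z'.1) ((π z'.1).2.1 z'.2)
    rw [← ENNReal.ofReal_sum_of_nonneg (fun z' _ => h0 z'), Fintype.sum_prod_type]
    have h1 : ∀ s' : S, ∑ a', M.P z.1 z.2 s' * π s' a' = M.P z.1 z.2 s' := fun s' => by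
      rw [← Finset.mul_sum, stdSimplex.sum_eq_one, mul_one]
    simp only [h1, (M.P_mem z.1 z.2).2, ENNReal.ofReal_one])

variable [MeasurableSpace S] [MeasurableSingletonClass S]
  [MeasurableSpace A] [MeasurableSingletonClass A]

/-- The one-step Markov kernel on state-action pairs under the policy `π`. -/
def stepKernel (M : MDP S A) (π : Policy S A) : Kernel (S × A) (S × A) :=
  Kernel.ofFunOfCountable (fun z => (M.stepPMF π z).toMeasure)

instance (M : MDP S A) (π : Policy S A) : IsMarkovKernel (M.stepKernel π) :=
  ⟨fun z => inferInstanceAs (IsProbabilityMeasure (M.stepPMF π z).toMeasure)⟩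

/-- The kernel giving the law of `(s_{n+1}, a_{n+1})` from the history up to time `n`; by the
Markov property only the last pair of the history matters. -/
def historyKernel (M : MDP S A) (π : Policy S A) (n : ℕ) :
    Kernel ((_ : Finset.Iic n) → S × A) (S × A) :=
  (M.stepKernel π).comap (fun x => x ⟨n, Finset.mem_Iic.2 le_rfl⟩) (measurable_pi_apply _)

instance (M : MDP S A) (π : Policy S A) (n : ℕ) : IsMarkovKernel (M.historyKernel π n) :=
  inferInstanceAs (IsMarkovKernel ((M.stepKernel π).comap _ _))

/-- The law of the infinite trajectory `(s_t, a_t)_{t ≥ 0}` generated by `π` from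
`(s_0, a_0) = z`. -/
def trajectory (M : MDP S A) (π : Policy S A) (z : S × A) : Measure (ℕ → S × A) :=
  Kernel.traj (X := fun _ => S × A) (M.historyKernel π) 0 (fun _ => z)

/-- The state-action value `Q^π(s, a) = E[∑_t γ^t r_t | s_0 = s, a_0 = a]`. -/
def Q (M : MDP S A) (π : Policy S A) (s : S) (a : A) : ℝ :=
  ∫ τ, ∑' t : ℕ, M.γ ^ t * M.R (τ t).1 (τ t).2 ∂(M.trajectory π (s, a))

/-- The state value `V^π(s) = E_{a ∼ π(·|s)}[Q^π(s, a)]`. -/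
def V (M : MDP S A) (π : Policy S A) (s : S) : ℝ :=
  ∑ a, π s a * M.Q π s a

/-- The optimal state value `V^*(s)`, the supremum of `V^π(s)` over all policies. -/
def Vopt (M : MDP S A) (s : S) : ℝ := ⨆ π : Policy S A, M.V π s

end MDP

section Grouping

variable {S A G : Type*} [Fintype S] [Fintype A] [Fintype G]

/-- A lower-level policy for the grouping `g`: for every group `h` a distribution over actions
which is carried by the actions of the group `h`. -/
structure LowerPolicy (g : A → G) where
  prob : G → A → ℝ
  prob_mem : ∀ h, prob h ∈ stdSimplex ℝ A
  prob_supp : ∀ h a, g a ≠ h → prob h a = 0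

/-- The hierarchical policy `πo ∘ πi`: `a` is played at `s` with probability
`πo(g a | s) πi(a | g a)`. -/
def joint {g : A → G} (πo : Policy S G) (πi : LowerPolicy g) : Policy S A := fun s =>
  ⟨fun a => πo s (g a) * πi.prob (g a) a,
    fun a => mul_nonneg ((πo s).2.1 _) ((πi.prob_mem _).1 _), by
    classical
    have h1 : ∀ a, πo s (g a) * πi.prob (g a) a
        = ∑ h, πo s h * πi.prob h a := fun a => by
      rw [Finset.sum_eq_single (g a)]
      · intro h _ hne
        rw [πi.prob_supp h a (fun e => hne e.symm), mul_zero]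
      · intro h; exact absurd (Finset.mem_univ _) h
    simp only [h1]
    rw [Finset.sum_comm]
    simp only [← Finset.mul_sum, (πi.prob_mem _).2, mul_one, stdSimplex.sum_eq_one]⟩

/-- The deterministic policy that plays `ρ s` at `s`. -/
def pointPolicy [DecidableEq G] (ρ : S → G) : Policy S G := fun s =>
  ⟨Pi.single (ρ s) 1, single_mem_stdSimplex ℝ (ρ s)⟩

/-- Grouped transition probabilities `P_G(s' | s, h) = E_{a ∼ πi(·|h)} P(s' | s, a)`. -/
def groupP (M : MDP S A) {g : A → G} (πi : LowerPolicy g) (s : S) (h : G) (s' : S) : ℝ :=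
  ∑ a, πi.prob h a * M.P s a s'

/-- Grouped rewards `R_G(s, h) = E_{a ∼ πi(·|h)} R(s, a)`. -/
def groupR (M : MDP S A) {g : A → G} (πi : LowerPolicy g) (s : S) (h : G) : ℝ :=
  ∑ a, πi.prob h a * M.R s a

/-- `β_P^* = 1 - min_{s, h} ∑_{s'} min_{a ∈ A_h} P(s' | s, a)`. -/
def betaP (M : MDP S A) (g : A → G) : ℝ :=
  1 - ⨅ p : S × G, ∑ s', ⨅ a : {a : A // g a = p.2}, M.P p.1 a s'

/-- `β_R^* = max_{s, g a₁ = g a₂} (R(s, a₁) - R(s, a₂))`. -/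
def betaR (M : MDP S A) (g : A → G) : ℝ :=
  ⨆ p : {p : S × A × A // g p.2.1 = g p.2.2}, (M.R p.1.1 p.1.2.1 - M.R p.1.1 p.1.2.2)

/-- The bound on the performance loss for grouping `g`, `K` samples in total, `T` iterations and
confidence parameter `δ`. -/
def epsPerf (M : MDP S A) (g : A → G) (δ : ℝ) (K T : ℕ) : ℝ :=
  2 * (betaR M g / (1 - M.γ) + M.γ * betaP M g / (1 - M.γ) ^ 2)
    + 20 * M.γ * √((Fintype.card S * Fintype.card G
        * Real.log (8 * Fintype.card S * Fintype.card G / (δ * (1 - M.γ))))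
          / (K * (1 - M.γ) ^ 3))
    + 8 * M.γ ^ T / (1 - M.γ) ^ 3

/-- Empirical transition probabilities: `x (s, h, k)` is the `k`-th next state drawn for the
pair `(s, h)`, out of `m` draws. -/
def empP [DecidableEq S] {m : ℕ} (x : S × G × Fin m → S) (s : S) (h : G) (s' : S) : ℝ :=
  ((Finset.univ.filter fun k : Fin m => x (s, h, k) = s').card : ℝ) / m

/-- Empirical rewards: the average over the `m` draws for the pair `(s, h)` of the observed
rewards, each of which equals `R_G(s, h)`. -/
def empR (M : MDP S A) {g : A → G} (πi : LowerPolicy g) (m : ℕ) (s : S) (h : G) : ℝ :=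
  (∑ _k : Fin m, groupR M πi s h) / m

end Grouping

section ValueIteration

variable {S G : Type*} [Fintype S] [Fintype G]

/-- The value-iteration iterates for transition probabilities `P`, rewards `R` and discount `γ`:
`Q^0 = 0` and `Q^{t+1}(s, h) = R(s, h) + γ ⟨P(· | s, h), max_{h'} Q^t(·, h')⟩`. -/
def qIter (P : S → G → S → ℝ) (R : S → G → ℝ) (γ : ℝ) : ℕ → S → G → ℝ
  | 0 => fun _ _ => 0
  | t + 1 => fun s h => R s h + γ * ∑ s', P s h s' * ⨆ h', qIter P R γ t s' h'

/-- `ρ(s) ∈ argmax_h q(s, h)` for every state `s`. -/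
def IsGreedy (q : S → G → ℝ) (ρ : S → G) : Prop := ∀ s h, q s h ≤ q s (ρ s)

/-- The real registers of the machine that runs value iteration: the discount factor, the
transition probabilities, the rewards, a `Q`-table and a table for `max_h Q(·, h)`. -/
inductive Reg (S G : Type*) where
  | disc : Reg S G
  | trans : S → G → S → Reg S G
  | rew : S → G → Reg S G
  | q : S → G → Reg S G
  | val : S → Reg S G
  deriving DecidableEq

/-- Unit-cost instructions.
`mul d x y`: `d := x * y`.
`fma d x y z`: `d := x * y + z`.
`start s h`: start a running maximum at `s`, that is `val s := q s h` and record `h` at `s`.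
`comp s h`: compare `val s` with `q s h`; if the latter is larger, update the running maximum
at `s` and the recorded group. -/
inductive Instr (S G : Type*) where
  | mul : Reg S G → Reg S G → Reg S G → Instr S G
  | fma : Reg S G → Reg S G → Reg S G → Reg S G → Instr S G
  | start : S → G → Instr S G
  | comp : S → G → Instr S G

/-- State of the machine: contents of the real registers, one recorded group for every state
(the policy), and the number of instructions executed so far. -/
structure Machine (S G : Type*) where
  mem : Reg S G → ℝ
  policy : S → G
  steps : ℕ

variable [DecidableEq S] [DecidableEq G]

/-- Execution of one instruction; each costs one step. -/
def exec (c : Machine S G) : Instr S G → Machine S G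
  | .mul d x y => ⟨Function.update c.mem d (c.mem x * c.mem y), c.policy, c.steps + 1⟩
  | .fma d x y z =>
    ⟨Function.update c.mem d (c.mem x * c.mem y + c.mem z), c.policy, c.steps + 1⟩
  | .start s h =>
    ⟨Function.update c.mem (.val s) (c.mem (.q s h)), Function.update c.policy s h, c.steps + 1⟩
  | .comp s h =>
    if c.mem (.val s) < c.mem (.q s h) then
      ⟨Function.update c.mem (.val s) (c.mem (.q s h)), Function.update c.policy s h, c.steps + 1⟩
    else ⟨c.mem, c.policy, c.steps + 1⟩

/-- Execution of a list of instructions, one after the other. -/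
def run (c : Machine S G) (prog : List (Instr S G)) : Machine S G := prog.foldl exec c

/-- Code for `q s h := ⟨P(· | s, h), val⟩`, the states being listed in `l`. -/
def innerCode (s : S) (h : G) : List S → List (Instr S G)
  | [] => []
  | s₀ :: l => .mul (.q s h) (.trans s h s₀) (.val s₀) ::
      l.map (fun s' => .fma (.q s h) (.trans s h s') (.val s') (.q s h))

/-- Code for `val s := max_h q s h`, recording a maximiser, the groups being listed in `l`. -/
def maxCode (s : S) : List G → List (Instr S G)
  | [] => []
  | h₀ :: l => .start s h₀ :: l.map (fun h => .comp s h)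

/-- One iteration: first `q s h := R(s, h) + γ ⟨P(· | s, h), val⟩` for all pairs `(s, h)`, then
`val s := max_h q s h` for all `s`. -/
def sweepCode (S G : Type*) [Fintype S] [Fintype G] : List (Instr S G) :=
  ((Finset.univ : Finset S).toList.flatMap fun s => (Finset.univ : Finset G).toList.flatMap fun h =>
    innerCode s h (Finset.univ : Finset S).toList ++
      [.fma (.q s h) .disc (.q s h) (.rew s h)])
  ++ (Finset.univ : Finset S).toList.flatMap fun s => maxCode s (Finset.univ : Finset G).toList

/-- The value-iteration program: `T` iterations. -/
def viCode (S G : Type*) [Fintype S] [Fintype G] (T : ℕ) : List (Instr S G) :=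
  (List.replicate T (sweepCode S G)).flatten

/-- Initial configuration: the model is in the input registers, the tables hold
`Q^0 = 0` and `max_h Q^0(·, h) = 0`, the recorded groups are arbitrary. -/
def initial (P : S → G → S → ℝ) (R : S → G → ℝ) (γ : ℝ) (ρ₀ : S → G) : Machine S G where
  mem := fun
    | .disc => γ
    | .trans s h s' => P s h s'
    | .rew s h => R s h
    | .q _ _ => 0
    | .val _ => 0
  policy := ρ₀
  steps := 0

/-- The final configuration of value iteration after `T` iterations. -/
def runVI (P : S → G → S → ℝ) (R : S → G → ℝ) (γ : ℝ) (ρ₀ : S → G) (T : ℕ) : Machine S G :=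
  run (initial P R γ ρ₀) (viCode S G T)

end ValueIteration

end

end GroupedMDP

/-! Consider the grouped model with kernel `groupP` and rewards `groupR`, whose actions are the
groups. A choice `ρ` of groups has the same value there as the corresponding hierarchical policy has
in `M` (`V_joint_pointPolicy`), so the loss splits into a grouping loss and an estimation loss.

Grouping loss (`V_le_optVal_group_add`): replacing an action by the average over its group costs at
most `β_R` in reward and `β_P / (1 - γ)` in expected next value per step. Discounting multiplies
this by `1 / (1 - γ)`.

Estimation loss: rewards are observed exactly, so only the kernel is estimated. Bernstein's
inequality bounds the one-step error by `κ` times the standard deviation of the next value, plus a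
lower-order term. Along the dynamics of a value function the discounted sum of these deviations is
of order `(1 - γ)^(-3/2)`, not `(1 - γ)^(-2)` (`exists_sqrt_wvar_potential`), which gives the rate.
`optVal_sub_le_of_deviation` turns such deviation bounds, together with near-greediness of `ρ` in
the empirical model, into a bound on the loss.

The bounds are needed on the empirical optimal value `U`, which depends on the very samples being
averaged. Making a state `s` absorbing with a prescribed value `u` removes the dependence on the
samples at `s`, and changes `U` by at most `|U s - u|` (`abs_optVal_sub_absorb_le`). Bernstein plus
a union bound over a finite grid of values `u` therefore suffices (`deviation_of_testFun`,
`one_sub_le_measureReal_deviation`).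

Value iteration from zero increases to the optimum with error `γ^t / (1 - γ)`, so its greedy
policies are nearly greedy for `U` (`optVal_le_of_isGreedy`). The program is verified through the
loop invariant `IsIterate`, and its cost is its length. -/

namespace GroupedMDP

noncomputable section

section Deterministic

variable {S G : Type*} [Fintype S]

/-! ### Averages against points of the simplex -/

lemma sum_mul_mem_Icc {p f : S → ℝ} (hp : p ∈ stdSimplex ℝ S) {a b : ℝ}
    (hf : ∀ s, f s ∈ Set.Icc a b) : ∑ s, p s * f s ∈ Set.Icc a b := by
  have h (c : ℝ) : ∑ s, p s * c = c := by rw [← Finset.sum_mul, hp.2, one_mul]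
  constructor
  · rw [← h a]
    exact Finset.sum_le_sum fun s _ => mul_le_mul_of_nonneg_left (hf s).1 (hp.1 s)
  · rw [← h b]
    exact Finset.sum_le_sum fun s _ => mul_le_mul_of_nonneg_left (hf s).2 (hp.1 s)

lemma abs_sum_mul_le {p f : S → ℝ} (hp : p ∈ stdSimplex ℝ S) {c : ℝ}
    (hf : ∀ s, |f s| ≤ c) : |∑ s, p s * f s| ≤ c :=
  abs_le.2 (sum_mul_mem_Icc hp fun s => abs_le.1 (hf s))

lemma sum_mul_mono {p f g : S → ℝ} (hp : p ∈ stdSimplex ℝ S) (h : ∀ s, f s ≤ g s) :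
    ∑ s, p s * f s ≤ ∑ s, p s * g s :=
  Finset.sum_le_sum fun s _ => mul_le_mul_of_nonneg_left (h s) (hp.1 s)

lemma sum_mul_const {p : S → ℝ} (hp : p ∈ stdSimplex ℝ S) (c : ℝ) : ∑ s, p s * c = c := by
  rw [← Finset.sum_mul, hp.2, one_mul]

/-- Maximum principle for discounted averages. -/
lemma le_div_of_le_add_average {γ : ℝ} (h0 : 0 ≤ γ) (h1 : γ < 1) {x : S → ℝ} {c : ℝ}
    (hx : ∀ s, ∃ p ∈ stdSimplex ℝ S, x s ≤ c + γ * ∑ s', p s' * x s') (s : S) :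
    x s ≤ c / (1 - γ) := by
  -- At a maximiser `s₀` the average is at most `x s₀`, hence `(1 - γ) * x s₀ ≤ c`.
  obtain ⟨s₀, -, hs₀⟩ := Finset.exists_max_image Finset.univ x ⟨s, Finset.mem_univ s⟩
  obtain ⟨p, hp, h⟩ := hx s₀
  have h2 : ∑ s', p s' * x s' ≤ x s₀ := by
    rw [← sum_mul_const hp (x s₀)]
    exact sum_mul_mono hp fun s' => hs₀ s' (Finset.mem_univ _)
  refine (hs₀ s (Finset.mem_univ _)).trans ?_
  rw [le_div_iff₀ (by linarith)]
  nlinarith [mul_le_mul_of_nonneg_left h2 h0]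

/-! ### Variance of a function under a distribution on a finite type -/

/-- Variance of `f` under the weights `p`. -/
def wvar (p f : S → ℝ) : ℝ := ∑ s, p s * (f s - ∑ s', p s' * f s') ^ 2

lemma wvar_nonneg {p : S → ℝ} (hp : p ∈ stdSimplex ℝ S) (f : S → ℝ) : 0 ≤ wvar p f :=
  Finset.sum_nonneg fun s _ => mul_nonneg (hp.1 s) (sq_nonneg _)

lemma wvar_eq {p : S → ℝ} (hp : p ∈ stdSimplex ℝ S) (f : S → ℝ) :
    wvar p f = ∑ s, p s * f s ^ 2 - (∑ s, p s * f s) ^ 2 := by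
  unfold wvar
  set e := ∑ s, p s * f s with he
  have h : ∀ s, p s * (f s - e) ^ 2 = p s * f s ^ 2 - 2 * e * (p s * f s) + p s * e ^ 2 :=
    fun s => by ring
  simp only [h, Finset.sum_add_distrib, Finset.sum_sub_distrib, ← Finset.mul_sum, ← he,
    sum_mul_const hp]
  ring

lemma wvar_le_sq {p f : S → ℝ} (hp : p ∈ stdSimplex ℝ S) {c : ℝ} (hf : ∀ s, |f s| ≤ c) :
    wvar p f ≤ c ^ 2 := by
  have h : ∑ s, p s * f s ^ 2 ≤ c ^ 2 := by
    rw [← sum_mul_const hp (c ^ 2)]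
    exact sum_mul_mono hp fun s => sq_le_sq' (abs_le.1 (hf s)).1 (abs_le.1 (hf s)).2
  rw [wvar_eq hp]
  nlinarith [sq_nonneg (∑ s, p s * f s)]

/-- The standard deviation is `1`-Lipschitz for the uniform norm. -/
lemma sqrt_wvar_le {p f g : S → ℝ} (hp : p ∈ stdSimplex ℝ S) {c : ℝ}
    (hc : 0 ≤ c) (h : ∀ s, |f s - g s| ≤ c) : √(wvar p f) ≤ √(wvar p g) + c := by
  have hd := wvar_le_sq hp h
  set F := fun s => f s - ∑ s', p s' * f s'
  set H := fun s => g s - ∑ s', p s' * g s'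
  have hD : wvar p (fun s => f s - g s) = ∑ s, p s * (F s - H s) ^ 2 := by
    unfold wvar
    refine Finset.sum_congr rfl fun s _ => ?_
    simp only [F, H, mul_sub, Finset.sum_sub_distrib]
    ring
  -- The triangle inequality in L²(p) for the centred functions: expand the square and control the
  -- cross term by Cauchy–Schwarz with weights `√(p s)`.
  have hF : wvar p f = wvar p g + 2 * ∑ s, (p s * H s * (F s - H s))
      + wvar p (fun s => f s - g s) := by
    rw [hD, Finset.mul_sum]
    unfold wvar
    rw [← Finset.sum_add_distrib, ← Finset.sum_add_distrib]
    exact Finset.sum_congr rfl fun s _ => by simp only [F, H]; ring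
  have hcs : (∑ s, p s * H s * (F s - H s)) ^ 2
      ≤ wvar p g * wvar p (fun s => f s - g s) := by
    have := Finset.sum_mul_sq_le_sq_mul_sq Finset.univ (fun s => √(p s) * H s)
      (fun s => √(p s) * (F s - H s))
    have e1 : ∀ s, √(p s) * H s * (√(p s) * (F s - H s)) = p s * H s * (F s - H s) := fun s => by
      rw [show √(p s) * H s * (√(p s) * (F s - H s)) = √(p s) * √(p s) * H s * (F s - H s) by ring,
        Real.mul_self_sqrt (hp.1 s)]
    simp only [e1, mul_pow, Real.sq_sqrt (hp.1 _)] at this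
    rw [hD]
    exact this
  have hg := wvar_nonneg hp g
  have hcross : ∑ s, p s * H s * (F s - H s) ≤ √(wvar p g) * c := by
    refine (Real.le_sqrt_of_sq_le (hcs.trans (mul_le_mul_of_nonneg_left hd hg))).trans_eq ?_
    rw [Real.sqrt_mul hg, Real.sqrt_sq hc]
  rw [Real.sqrt_le_left (by positivity)]
  nlinarith [Real.sq_sqrt hg]

/-! ### Optimal values -/

/-- Bellman optimality operator. -/
def bellman (P : S → G → S → ℝ) (R : S → G → ℝ) (γ : ℝ) (V : S → ℝ) (s : S) : ℝ :=
  ⨆ h, (R s h + γ * ∑ s', P s h s' * V s')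

/-- Optimal value function: the fixed point of the Bellman optimality operator. -/
def optVal (P : S → G → S → ℝ) (R : S → G → ℝ) (γ : ℝ) : S → ℝ :=
  Classical.epsilon fun V => bellman P R γ V = V

variable {P : S → G → S → ℝ} {R : S → G → ℝ} {γ : ℝ} [Fintype G]

lemma le_bellman (V : S → ℝ) (s : S) (h : G) :
    R s h + γ * ∑ s', P s h s' * V s' ≤ bellman P R γ V s :=
  le_ciSup (f := fun h => R s h + γ * ∑ s', P s h s' * V s') (Set.finite_range _).bddAbove h

variable [Nonempty G]

lemma exists_bellman_eq (P : S → G → S → ℝ) (R : S → G → ℝ) (γ : ℝ) (V : S → ℝ) (s : S) :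
    ∃ h, bellman P R γ V s = R s h + γ * ∑ s', P s h s' * V s' := by
  obtain ⟨h, hh⟩ := exists_eq_ciSup_of_finite (f := fun h => R s h + γ * ∑ s', P s h s' * V s')
  exact ⟨h, hh.symm⟩

/-- Test each maximiser in the other maximum. Since kernels, rewards and functions may all differ,
this serves both for the contraction property and for comparing two models. -/
lemma abs_bellman_sub_le {P' : S → G → S → ℝ} {R' : S → G → ℝ} {V V' : S → ℝ} {c : ℝ} {s : S}
    (h : ∀ h, |(R s h + γ * ∑ s', P s h s' * V s') - (R' s h + γ * ∑ s', P' s h s' * V' s')| ≤ c) :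
    |bellman P R γ V s - bellman P' R' γ V' s| ≤ c := by
  obtain ⟨a, ha⟩ := exists_bellman_eq P R γ V s
  obtain ⟨b, hb⟩ := exists_bellman_eq P' R' γ V' s
  have h1 := le_bellman (P := P) (R := R) (γ := γ) V s b
  have h2 := le_bellman (P := P') (R := R') (γ := γ) V' s a
  have h3 := abs_le.1 (h a)
  have h4 := abs_le.1 (h b)
  rw [abs_le]
  constructor <;> linarith

/-- Banach's fixed-point theorem in the sup norm supplies a fixed point, so the `Classical.epsilon`
in `optVal` picks a genuine one. -/
lemma bellman_optVal (hP : ∀ s h, P s h ∈ stdSimplex ℝ S) (h0 : 0 ≤ γ) (h1 : γ < 1) :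
    bellman P R γ (optVal P R γ) = optVal P R γ := by
  have hc : ContractingWith ⟨γ, h0⟩ (bellman P R γ) := by
    refine ⟨h1, LipschitzWith.of_dist_le_mul fun V W => ?_⟩
    refine (dist_pi_le_iff (by positivity)).2 fun s => ?_
    rw [Real.dist_eq]
    refine abs_bellman_sub_le fun h => ?_
    rw [add_sub_add_left_eq_sub, ← mul_sub, ← Finset.sum_sub_distrib, abs_mul, abs_of_nonneg h0]
    refine mul_le_mul_of_nonneg_left ?_ h0
    simp only [← mul_sub]
    exact abs_sum_mul_le (hP s h) fun s' => by
      rw [← Real.dist_eq]; exact dist_le_pi_dist V W s'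
  exact Classical.epsilon_spec (p := fun V => bellman P R γ V = V)
    ⟨_, hc.fixedPoint_isFixedPt⟩

lemma le_optVal (hP : ∀ s h, P s h ∈ stdSimplex ℝ S) (h0 : 0 ≤ γ) (h1 : γ < 1) (s : S) (h : G) :
    R s h + γ * ∑ s', P s h s' * optVal P R γ s' ≤ optVal P R γ s := by
  conv_rhs => rw [← bellman_optVal hP h0 h1]
  exact le_bellman _ s h

lemma exists_optVal_eq (hP : ∀ s h, P s h ∈ stdSimplex ℝ S) (h0 : 0 ≤ γ) (h1 : γ < 1) (s : S) :
    ∃ h, optVal P R γ s = R s h + γ * ∑ s', P s h s' * optVal P R γ s' := by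
  obtain ⟨h, hh⟩ := exists_bellman_eq P R γ (optVal P R γ) s
  rw [bellman_optVal hP h0 h1] at hh
  exact ⟨h, hh⟩

lemma optVal_mem_Icc (hP : ∀ s h, P s h ∈ stdSimplex ℝ S) (hR : ∀ s h, R s h ∈ Set.Icc 0 1)
    (h0 : 0 ≤ γ) (h1 : γ < 1) (s : S) : optVal P R γ s ∈ Set.Icc 0 (1 / (1 - γ)) := by
  constructor
  · have := le_div_of_le_add_average h0 h1 (x := fun s => - optVal P R γ s) (c := 0) (fun s => by
      obtain ⟨h⟩ := ‹Nonempty G›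
      refine ⟨P s h, hP s h, ?_⟩
      have := le_optVal (R := R) hP h0 h1 s h
      simp only [mul_neg, Finset.sum_neg_distrib]
      linarith [(hR s h).1]) s
    simp only [zero_div] at this
    linarith
  · refine le_div_of_le_add_average h0 h1 (x := optVal P R γ) (fun s => ?_) s
    obtain ⟨h, hh⟩ := exists_optVal_eq (R := R) hP h0 h1 s
    refine ⟨P s h, hP s h, ?_⟩
    linarith [(hR s h).2]

/-- Approximate fixed points of the Bellman operator are close to the optimal value. -/
lemma abs_sub_optVal_le (hP : ∀ s h, P s h ∈ stdSimplex ℝ S) (h0 : 0 ≤ γ) (h1 : γ < 1)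
    {W : S → ℝ} {c : ℝ} (hW : ∀ s, |bellman P R γ W s - W s| ≤ c) (s : S) :
    |W s - optVal P R γ s| ≤ c / (1 - γ) := by
  refine abs_sub_le_iff.2
    ⟨le_div_of_le_add_average h0 h1 (x := fun s => W s - optVal P R γ s) (fun s => ?_) s,
    le_div_of_le_add_average h0 h1 (x := fun s => optVal P R γ s - W s) (fun s => ?_) s⟩
  · obtain ⟨h, hh⟩ := exists_bellman_eq P R γ W s
    refine ⟨P s h, hP s h, ?_⟩
    have := le_optVal (R := R) hP h0 h1 s h
    have := (abs_le.1 (hW s)).1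
    simp only [mul_sub, Finset.sum_sub_distrib]
    linarith
  · obtain ⟨h, hh⟩ := exists_optVal_eq (R := R) hP h0 h1 s
    refine ⟨P s h, hP s h, ?_⟩
    have := le_bellman (P := P) (R := R) (γ := γ) W s h
    have := (abs_le.1 (hW s)).2
    simp only [mul_sub, Finset.sum_sub_distrib]
    linarith

/-! ### Discounted sums of standard deviations -/

/-- The potential whose one-step discounted decrease dominates the variance of a value function. -/
lemma wvar_le_potential {p V : S → ℝ} {r v : ℝ} (hp : p ∈ stdSimplex ℝ S) (h1 : γ < 1)
    (hr : 0 ≤ r) (hV : ∀ s, V s ∈ Set.Icc 0 (1 / (1 - γ)))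
    (hv : v = r + γ * ∑ s', p s' * V s') (hv' : v ∈ Set.Icc 0 (1 / (1 - γ))) :
    wvar p V ≤ (2 / (1 - γ) ^ 2 - (1 / (1 - γ) - v) ^ 2)
      - γ * ∑ s', p s' * (2 / (1 - γ) ^ 2 - (1 / (1 - γ) - V s') ^ 2) := by
  set D := 1 / (1 - γ) with hD
  have hD1 : (1 - γ) * D = 1 := by rw [hD]; field_simp [show (1 - γ) ≠ 0 by linarith]
  have hN : 2 / (1 - γ) ^ 2 = 2 * D ^ 2 := by rw [hD, div_pow, one_pow]; ring
  rw [hN, wvar_eq hp]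
  have e1 : ∀ s, p s * (2 * D ^ 2 - (D - V s) ^ 2)
      = p s * D ^ 2 + 2 * D * (p s * V s) - p s * V s ^ 2 := fun s => by ring
  simp only [e1, Finset.sum_sub_distrib, Finset.sum_add_distrib, ← Finset.mul_sum,
    sum_mul_const hp]
  have hm := sum_mul_mem_Icc hp hV
  have hq : ∑ s, p s * V s ^ 2 ≤ D ^ 2 := by
    rw [← sum_mul_const hp (D ^ 2)]
    exact sum_mul_mono hp fun s => pow_le_pow_left₀ (hV s).1 (hV s).2 2
  set a := ∑ s, p s * V s
  set q := ∑ s, p s * V s ^ 2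
  obtain ⟨ha0, ha1⟩ := hm
  obtain ⟨hv0, hv1⟩ := hv'
  have hg : 0 < 1 - γ := by linarith
  -- After expansion, with `a` and `q` the first two moments of `V`, the claim is `(1 - γ) * q + v ^
  -- 2 - a ^ 2 ≤ D + 2 * D * r`; `h3` and `h4` bound the two parts.
  have h3 : (1 - γ) * q ≤ D := by
    have := mul_le_mul_of_nonneg_left hq hg.le
    nlinarith
  have h4 : v ^ 2 - a ^ 2 ≤ 2 * D * r := by
    have e : v - a ≤ r := by rw [hv]; nlinarith
    have : (v - a) * (v + a) ≤ r * (v + a) := mul_le_mul_of_nonneg_right e (by linarith)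
    nlinarith [mul_le_mul_of_nonneg_left (show v + a ≤ 2 * D by linarith) hr]
  have h5 : γ * a = v - r := by linarith
  have h6 : γ * D ^ 2 = D ^ 2 - D := by linear_combination (-D) * hD1
  nlinarith

/-- A one-step domination of the standard deviation of a value function. -/
lemma exists_sqrt_wvar_potential (h1 : γ < 1) {V : S → ℝ}
    (hV : ∀ s, V s ∈ Set.Icc 0 (1 / (1 - γ))) :
    ∃ H : S → ℝ, (∀ s, H s ≤ √(2 / (1 - γ)) / (1 - γ)) ∧
      ∀ s, ∀ p ∈ stdSimplex ℝ S, ∀ r, 0 ≤ r → V s = r + γ * ∑ s', p s' * V s' →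
        √(wvar p V) + γ * ∑ s', p s' * H s' ≤ H s := by
  have hg : 0 < 1 - γ := by linarith
  set a := √(2 / (1 - γ)) with ha
  have ha0 : 0 < a := Real.sqrt_pos.2 (by positivity)
  have ha2 : a ^ 2 = 2 / (1 - γ) := Real.sq_sqrt (by positivity)
  have ha3 : (1 - γ) * a ^ 2 = 2 := by rw [ha2]; field_simp
  set F : S → ℝ := fun s => 2 / (1 - γ) ^ 2 - (1 / (1 - γ) - V s) ^ 2 with hF
  -- By AM-GM, `√v ≤ a / 2 + v / (2 * a)`. The first summand of `H` pays for the constant `a / 2` at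
  -- every step, the second for the variance through the potential `F`. With `a ^ 2 = 2 / (1 - γ)`
  -- both summands have the same upper bound.
  refine ⟨fun s => a / (2 * (1 - γ)) + F s / (2 * a), fun s => ?_, fun s p hp r hr hs => ?_⟩
  · have h2 : F s ≤ 2 / (1 - γ) ^ 2 := by
      simp only [hF]; linarith [sq_nonneg (1 / (1 - γ) - V s)]
    have h3 : F s / (2 * a) ≤ a / (2 * (1 - γ)) := by
      rw [div_le_iff₀ (by positivity)]
      refine h2.trans_eq ?_
      rw [show a / (2 * (1 - γ)) * (2 * a) = a ^ 2 / (1 - γ) by field_simp, ha2]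
      field_simp
    calc _ ≤ a / (2 * (1 - γ)) + a / (2 * (1 - γ)) := by linarith
      _ = _ := by field_simp; ring
  · have h2 := wvar_le_potential hp h1 hr hV hs (hV s)
    have h3 : √(wvar p V) ≤ a / 2 + wvar p V / (2 * a) := by
      have h4 := Real.sq_sqrt (wvar_nonneg hp V)
      rw [← sub_nonneg]
      have : a / 2 + wvar p V / (2 * a) - √(wvar p V) = (a - √(wvar p V)) ^ 2 / (2 * a) := by
        field_simp; rw [sub_sq, h4]; ring
      rw [this]; positivity
    have h5 : ∑ s', p s' * (a / (2 * (1 - γ)) + F s' / (2 * a))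
        = a / (2 * (1 - γ)) + (∑ s', p s' * F s') / (2 * a) := by
      simp only [mul_add, Finset.sum_add_distrib, sum_mul_const hp, Finset.sum_div, mul_div_assoc]
    rw [h5]
    have h6 : wvar p V / (2 * a) ≤ (F s - γ * ∑ s', p s' * F s') / (2 * a) :=
      div_le_div_of_nonneg_right h2 (by positivity)
    have h7 : a / (2 * (1 - γ)) = a / 2 + γ * (a / (2 * (1 - γ))) := by field_simp; ring
    rw [sub_div] at h6
    have h8 : γ * ((∑ s', p s' * F s') / (2 * a)) = γ * (∑ s', p s' * F s') / (2 * a) := by ring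
    linarith

/-- If the deviation of `P'` from `P` on the value `U` is of Bernstein type and `V - U` is
bounded by a discounted sum of deviations along `V`'s own dynamics, then `V - U` is small. -/
lemma sub_le_of_deviation (h0 : 0 ≤ γ) (h1 : γ < 1) {V U x : S → ℝ}
    (hV : ∀ s, V s ∈ Set.Icc 0 (1 / (1 - γ))) {κ c e z : ℝ} (hκ : 0 ≤ κ) (hz : 0 ≤ z)
    (hUV : ∀ s, |U s - V s| ≤ z)
    (hx : ∀ s, ∃ p ∈ stdSimplex ℝ S, ∃ r, 0 ≤ r ∧ V s = r + γ * ∑ s', p s' * V s' ∧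
      x s ≤ γ * ∑ s', p s' * x s' + γ * (κ * √(wvar p U) + c) + e) (s : S) :
    x s ≤ γ * (κ * (√(2 / (1 - γ)) / (1 - γ))) + (γ * (κ * z + c) + e) / (1 - γ) := by
  obtain ⟨H, hH, hH'⟩ := exists_sqrt_wvar_potential h1 hV
  -- Subtracting `γ * κ * H` absorbs the standard deviations of `V`; replacing `U` by `V` inside the
  -- deviation costs `z`, leaving a constant per-step error for the maximum principle.
  have key := le_div_of_le_add_average h0 h1 (x := fun s => x s - γ * κ * H s)
    (c := γ * (κ * z + c) + e) (fun s => by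
      obtain ⟨p, hp, r, hr, hVs, hxs⟩ := hx s
      refine ⟨p, hp, ?_⟩
      have h2 := hH' s p hp r hr hVs
      have h3 := sqrt_wvar_le hp hz hUV
      have h4 : γ * κ * √(wvar p U) ≤ γ * κ * (√(wvar p V) + z) :=
        mul_le_mul_of_nonneg_left h3 (by positivity)
      have h5 : γ * κ * (√(wvar p V) + γ * ∑ s', p s' * H s') ≤ γ * κ * H s :=
        mul_le_mul_of_nonneg_left h2 (by positivity)
      have h6 : ∑ s', p s' * (x s' - γ * κ * H s')
          = ∑ s', p s' * x s' - γ * κ * ∑ s', p s' * H s' := by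
        rw [Finset.mul_sum, ← Finset.sum_sub_distrib]
        exact Finset.sum_congr rfl fun _ _ => by ring
      rw [h6]
      nlinarith) s
  have := mul_le_mul_of_nonneg_left (hH s) (show 0 ≤ γ * κ by positivity)
  linarith

/-- Performance loss of a near-greedy policy `ρ` of an approximate model `P'`, in terms of
Bernstein-type deviations of `P'` on its own optimal value. -/
theorem optVal_sub_le_of_deviation {P' : S → G → S → ℝ} (hP : ∀ s h, P s h ∈ stdSimplex ℝ S)
    (hP' : ∀ s h, P' s h ∈ stdSimplex ℝ S)
    (hR : ∀ s h, R s h ∈ Set.Icc 0 1) (h0 : 0 ≤ γ) (h1 : γ < 1) {ρ : S → G} {W : S → ℝ}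
    (hW : ∀ s, W s = R s (ρ s) + γ * ∑ s', P s (ρ s) s' * W s')
    {κ c e : ℝ} (hκ : 0 ≤ κ) (hκ' : 9 * κ ≤ 1 - γ) (hc : 0 ≤ c) (he : 0 ≤ e)
    (hdev : ∀ s h, |∑ s', P' s h s' * optVal P' R γ s' - ∑ s', P s h s' * optVal P' R γ s'|
      ≤ κ * √(wvar (P s h) (optVal P' R γ)) + c)
    (hgr : ∀ s, optVal P' R γ s
      ≤ R s (ρ s) + γ * ∑ s', P' s (ρ s) s' * optVal P' R γ s' + e) (s : S) :
    optVal P R γ s - W s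
      ≤ 9 / 4 * (γ * (κ * (√(2 / (1 - γ)) / (1 - γ))) + (γ * c + e) / (1 - γ)) := by
  have hg : 0 < 1 - γ := by linarith
  have hVI := optVal_mem_Icc hP hR h0 h1
  have hWV : ∀ s, W s ≤ optVal P R γ s := by
    intro s
    have := le_div_of_le_add_average h0 h1 (x := fun s => W s - optVal P R γ s) (c := 0)
      (fun s => by
        refine ⟨P s (ρ s), hP _ _, ?_⟩
        have := le_optVal (R := R) hP h0 h1 s (ρ s)
        simp only [mul_sub, Finset.sum_sub_distrib]
        rw [hW s]
        linarith) s
    simp only [zero_div] at this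
    linarith
  have hW0 : ∀ s, 0 ≤ W s := by
    intro s
    have := le_div_of_le_add_average h0 h1 (x := fun s => - W s) (c := 0)
      (fun s => by
        refine ⟨P s (ρ s), hP _ _, ?_⟩
        simp only [mul_neg, Finset.sum_neg_distrib]
        rw [hW s]
        linarith [(hR s (ρ s)).1]) s
    simp only [zero_div] at this
    linarith
  have hWI : ∀ s, W s ∈ Set.Icc 0 (1 / (1 - γ)) := fun s =>
    ⟨hW0 s, (hWV s).trans (hVI s).2⟩
  set V := optVal P R γ with hVdef
  set U := optVal P' R γ with hUdef
  -- Because `W ≤ V`, the one-sided bounds `V - U ≤ z` and `U - W ≤ z` already give `|U - V| ≤ z`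
  -- and `|U - W| ≤ z`. Both recursions can thus share one `z`.
  obtain ⟨s₁, -, hs₁⟩ := Finset.exists_max_image Finset.univ
    (fun s => max (max (V s - U s) (U s - W s)) 0) ⟨s, Finset.mem_univ s⟩
  set z := max (max (V s₁ - U s₁) (U s₁ - W s₁)) 0 with hzdef
  have hz0 : 0 ≤ z := le_max_right _ _
  have hzx : ∀ s, V s - U s ≤ z := fun s =>
    ((le_max_left _ _).trans (le_max_left _ _)).trans (hs₁ s (Finset.mem_univ _))
  have hzy : ∀ s, U s - W s ≤ z := fun s =>
    ((le_max_right _ _).trans (le_max_left _ _)).trans (hs₁ s (Finset.mem_univ _))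
  have hx := sub_le_of_deviation h0 h1 (V := V) (U := U) (x := fun s => V s - U s)
    (κ := κ) (c := c) (e := e) (z := z) hVI hκ hz0
    (fun s => abs_sub_le_iff.2 ⟨by linarith [hzy s, hWV s], hzx s⟩) (fun s => by
      -- Follow the group optimal for `V`: it is exact for `V` and only a lower bound for `U`.
      obtain ⟨h, hh⟩ := exists_optVal_eq (R := R) hP h0 h1 s
      refine ⟨P s h, hP s h, R s h, (hR s h).1, hh, ?_⟩
      have h2 := le_optVal (R := R) hP' h0 h1 s h
      have h3 := mul_le_mul_of_nonneg_left (abs_le.1 (hdev s h)).1 h0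
      rw [← hVdef] at hh
      rw [← hUdef] at h2
      simp only [mul_sub, Finset.sum_sub_distrib]
      linarith)
  have hy := sub_le_of_deviation h0 h1 (V := W) (U := U) (x := fun s => U s - W s)
    (κ := κ) (c := c) (e := e) (z := z) hWI hκ hz0
    (fun s => abs_sub_le_iff.2 ⟨hzy s, by linarith [hzx s, hWV s]⟩) (fun s => by
      refine ⟨P s (ρ s), hP _ _, R s (ρ s), (hR _ _).1, hW s, ?_⟩
      have h2 := hgr s
      have h3 := mul_le_mul_of_nonneg_left (abs_le.1 (hdev s (ρ s))).2 h0
      have h4 := hW s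
      simp only [mul_sub, Finset.sum_sub_distrib]
      linarith)
  set B := γ * (κ * (√(2 / (1 - γ)) / (1 - γ))) with hB
  have hB0 : 0 ≤ B := by positivity
  have hz : z ≤ B + (γ * (κ * z + c) + e) / (1 - γ) :=
    max_le (max_le (hx s₁) (hy s₁)) (by positivity)
  have h4 : (γ * (κ * z + c) + e) / (1 - γ) = γ * (κ * z) / (1 - γ) + (γ * c + e) / (1 - γ) := by
    rw [← add_div]; congr 1; ring
  -- Self-bounding: the term in `z` on the right is at most `z / 9`, so `z` is at most `9 / 8` of
  -- the rest, and `V - W ≤ 2 * z` yields `9 / 4`.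
  have h5 : γ * (κ * z) / (1 - γ) ≤ z / 9 := by
    rw [div_le_iff₀ hg]
    nlinarith [mul_le_mul_of_nonneg_right hκ' hz0, mul_nonneg hκ hz0]
  rw [h4] at hz
  linarith [hzx s, hzy s]

/-! ### Value iteration -/

lemma qIter_iSup_le_optVal (hP : ∀ s h, P s h ∈ stdSimplex ℝ S)
    (hR : ∀ s h, R s h ∈ Set.Icc 0 1) (h0 : 0 ≤ γ) (h1 : γ < 1) (t : ℕ) (s : S) :
    ⨆ h, qIter P R γ t s h ≤ optVal P R γ s := by
  induction t generalizing s with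
  | zero => simpa [qIter] using (optVal_mem_Icc hP hR h0 h1 s).1
  | succ t ih =>
    refine ciSup_le fun h => ?_
    refine le_trans ?_ (le_optVal hP h0 h1 s h)
    have := mul_le_mul_of_nonneg_left (sum_mul_mono (hP s h) ih) h0
    simp only [qIter]
    linarith

lemma optVal_le_qIter_iSup (hP : ∀ s h, P s h ∈ stdSimplex ℝ S)
    (hR : ∀ s h, R s h ∈ Set.Icc 0 1) (h0 : 0 ≤ γ) (h1 : γ < 1) (t : ℕ) (s : S) :
    optVal P R γ s ≤ (⨆ h, qIter P R γ t s h) + γ ^ t / (1 - γ) := by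
  induction t generalizing s with
  | zero => simpa [qIter] using (optVal_mem_Icc hP hR h0 h1 s).2
  | succ t ih =>
    obtain ⟨h, hh⟩ := exists_optVal_eq (R := R) hP h0 h1 s
    have h2 : qIter P R γ (t + 1) s h ≤ ⨆ h, qIter P R γ (t + 1) s h :=
      le_ciSup (f := fun h => qIter P R γ (t + 1) s h) (Set.finite_range _).bddAbove h
    have h3 := mul_le_mul_of_nonneg_left (sum_mul_mono (hP s h) ih) h0
    simp only [mul_add, Finset.sum_add_distrib, sum_mul_const (hP s h)] at h3
    have h4 : qIter P R γ (t + 1) s h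
      = R s h + γ * ∑ s', P s h s' * ⨆ h', qIter P R γ t s' h' := rfl
    have h5 : γ ^ (t + 1) / (1 - γ) = γ * (γ ^ t / (1 - γ)) := by ring
    linarith

/-- A greedy policy of the value-iteration iterate is nearly greedy for the optimal value. -/
lemma optVal_le_of_isGreedy (hP : ∀ s h, P s h ∈ stdSimplex ℝ S)
    (hR : ∀ s h, R s h ∈ Set.Icc 0 1) (h0 : 0 ≤ γ) (h1 : γ < 1) {t : ℕ} {ρ : S → G}
    (hρ : IsGreedy (qIter P R γ t) ρ) (s : S) :
    optVal P R γ s ≤ R s (ρ s) + γ * ∑ s', P s (ρ s) s' * optVal P R γ s' + γ ^ t / (1 - γ) := by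
  refine (optVal_le_qIter_iSup hP hR h0 h1 t s).trans ?_
  gcongr
  refine (ciSup_le (hρ s)).trans ?_
  cases t with
  -- The zero table makes every `ρ` greedy; nonnegativity of rewards and values is enough here.
  | zero =>
    have := mul_nonneg h0
      (sum_mul_mem_Icc (hP s (ρ s)) (optVal_mem_Icc (R := R) hP hR h0 h1)).1
    simp only [qIter]
    linarith [(hR s (ρ s)).1]
  | succ t =>
    simp only [qIter]
    -- The iterates lie below the optimum, so no second error term arises when passing from the
    -- iterate to `optVal`.
    have := mul_le_mul_of_nonneg_left
      (sum_mul_mono (hP s (ρ s)) (qIter_iSup_le_optVal hP hR h0 h1 t)) h0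
    linarith

end Deterministic

/-! ### Correctness and running time of the value-iteration program -/

section Machine

variable {S G : Type*} [DecidableEq S] [DecidableEq G]

lemma exec_steps (c : Machine S G) (i : Instr S G) : (exec c i).steps = c.steps + 1 := by
  cases i <;> simp only [exec]
  split_ifs <;> rfl

lemma run_steps (c : Machine S G) (l : List (Instr S G)) :
    (run c l).steps = c.steps + l.length := by
  induction l generalizing c with
  | nil => rfl
  | cons i l ih =>
    change (run (exec c i) l).steps = _
    rw [ih, exec_steps, List.length_cons]
    omega

lemma run_append (c : Machine S G) (l l' : List (Instr S G)) :
    run c (l ++ l') = run (run c l) l' := List.foldl_append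

lemma run_singleton (c : Machine S G) (i : Instr S G) : run c [i] = exec c i := rfl

lemma run_fma_list (c : Machine S G) (s : S) (h : G) (l : List S) :
    (run c (l.map fun s' => .fma (.q s h) (.trans s h s') (.val s') (.q s h))).mem
        = Function.update c.mem (.q s h)
          (c.mem (.q s h) + (l.map fun s' => c.mem (.trans s h s') * c.mem (.val s')).sum) ∧
      (run c (l.map fun s' => .fma (.q s h) (.trans s h s') (.val s') (.q s h))).policy
        = c.policy := by
  induction l using List.reverseRecOn with
  | nil => simp [run]
  | append_singleton l a ih =>
    rw [List.map_append, List.map_singleton, run_append, run_singleton]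
    refine ⟨?_, ih.2⟩
    simp only [exec, ih.1, Function.update_idem, List.map_append, List.sum_append,
      List.map_singleton, List.sum_singleton]
    congr 1
    simp
    ring

/-- The leading `mul` overwrites the accumulator, so its old content is irrelevant. -/
lemma run_innerCode (c : Machine S G) (s : S) (h : G) (l : List S) (hl : l ≠ []) :
    (run c (innerCode s h l)).mem = Function.update c.mem (.q s h)
        ((l.map fun s' => c.mem (.trans s h s') * c.mem (.val s')).sum) ∧
      (run c (innerCode s h l)).policy = c.policy := by
  cases l with
  | nil => exact absurd rfl hl
  | cons a l =>
    have := run_fma_list (exec c (.mul (.q s h) (.trans s h a) (.val a))) s h l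
    refine ⟨this.1.trans ?_, this.2⟩
    simp [exec]

/-- The running-maximum invariant: `val s` holds the entry of the recorded group and dominates every
entry scanned so far. The `q` registers are only read. -/
lemma run_comp_list (c : Machine S G) (s : S) (h₀ : G) (l : List G) :
    let d := run c (.start s h₀ :: l.map fun h => .comp s h)
    (∀ r, r ≠ .val s → d.mem r = c.mem r) ∧ (∀ s', s' ≠ s → d.policy s' = c.policy s') ∧
      d.mem (.val s) = c.mem (.q s (d.policy s)) ∧
      ∀ h ∈ h₀ :: l, c.mem (.q s h) ≤ d.mem (.val s) := by
  induction l using List.reverseRecOn with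
  | nil =>
    simp only [List.map_nil, run_singleton, exec]
    refine ⟨fun r hr => by simp [hr], fun s' hs => by simp [hs], by simp, by simp⟩
  | append_singleton l a ih =>
    rw [List.map_append, List.map_singleton, ← List.cons_append, run_append, run_singleton]
    obtain ⟨h1, h2, h3, h4⟩ := ih
    set d := run c (.start s h₀ :: l.map fun h => .comp s h)
    have hq : d.mem (.q s a) = c.mem (.q s a) := h1 _ (by simp)
    simp only [exec]
    split_ifs with hlt
    · refine ⟨fun r hr => by simp [hr, h1], fun s' hs => by simp [hs, h2], by simp [hq], ?_⟩
      intro h hh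
      simp only [Function.update_self]
      rw [← List.cons_append, List.mem_append, List.mem_singleton] at hh
      rcases hh with hh | rfl
      · exact (h4 h hh).trans hlt.le
      · exact hq.ge
    · refine ⟨h1, h2, h3, fun h hh => ?_⟩
      rw [← List.cons_append, List.mem_append, List.mem_singleton] at hh
      rcases hh with hh | rfl
      · exact h4 h hh
      · exact hq ▸ not_lt.1 hlt

lemma run_maxCode (c : Machine S G) (s : S) (l : List G) (hl : l ≠ []) :
    (∀ r, r ≠ .val s → (run c (maxCode s l)).mem r = c.mem r) ∧
      (∀ s', s' ≠ s → (run c (maxCode s l)).policy s' = c.policy s') ∧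
      (run c (maxCode s l)).mem (.val s) = c.mem (.q s ((run c (maxCode s l)).policy s)) ∧
      ∀ h ∈ l, c.mem (.q s h) ≤ (run c (maxCode s l)).mem (.val s) := by
  cases l with
  | nil => exact absurd rfl hl
  | cons a l => exact run_comp_list c s a l

lemma run_flatMap_maxCode (c : Machine S G) (k : List G) (hk : k ≠ []) (l : List S) :
    (∀ r, (∀ s ∈ l, r ≠ .val s) → (run c (l.flatMap fun s => maxCode s k)).mem r = c.mem r) ∧
      ∀ s ∈ l, (run c (l.flatMap fun s => maxCode s k)).mem (.val s)
          = c.mem (.q s ((run c (l.flatMap fun s => maxCode s k)).policy s)) ∧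
        ∀ h ∈ k, c.mem (.q s h) ≤ (run c (l.flatMap fun s => maxCode s k)).mem (.val s) := by
  induction l using List.reverseRecOn with
  | nil => simp [run]
  | append_singleton l a ih =>
    rw [List.flatMap_append, List.flatMap_singleton, run_append]
    obtain ⟨h1, h2⟩ := ih
    set d := run c (l.flatMap fun s => maxCode s k)
    obtain ⟨k1, k2, k3, k4⟩ := run_maxCode d a k hk
    have hq (s h) : d.mem (.q s h) = c.mem (.q s h) := h1 _ (by simp)
    simp only [hq] at k3 k4
    refine ⟨fun r hr => ?_, fun s hs => ?_⟩
    · rw [k1 r (hr a (by simp)), h1 r fun s hs => hr s (by simp [hs])]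
    · by_cases hsa : s = a
      · subst hsa
        exact ⟨k3, k4⟩
      · have hs' : s ∈ l := by simpa [hsa] using hs
        rw [k1 (.val s) (by simpa using hsa), k2 s hsa]
        exact h2 s hs'

end Machine

section SweepCode

variable {S G : Type*} [Fintype S]

/-- Code for one entry of the `Q`-table. -/
def entryCode (p : S × G) : List (Instr S G) :=
  innerCode p.1 p.2 (Finset.univ : Finset S).toList ++
    [.fma (.q p.1 p.2) .disc (.q p.1 p.2) (.rew p.1 p.2)]

lemma sweepCode_eq [Fintype G] : sweepCode S G
    = ((Finset.univ : Finset S).toList ×ˢ (Finset.univ : Finset G).toList).flatMap entryCode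
      ++ (Finset.univ : Finset S).toList.flatMap
          fun s => maxCode s (Finset.univ : Finset G).toList := by
  simp only [sweepCode, SProd.sprod, List.product, List.flatMap_assoc, List.flatMap_map, entryCode]

end SweepCode

section MachineFintype

variable {S G : Type*} [Fintype S] [DecidableEq S] [DecidableEq G]

/-- The value that `entryCode (s, h)` writes into `q s h`. -/
def entryVal (c : Machine S G) (p : S × G) : ℝ :=
  c.mem .disc * ∑ s', c.mem (.trans p.1 p.2 s') * c.mem (.val s') + c.mem (.rew p.1 p.2)

lemma run_entryCode (c : Machine S G) (p : S × G) :
    (run c (entryCode p)).mem = Function.update c.mem (.q p.1 p.2) (entryVal c p) := by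
  have hl : (Finset.univ : Finset S).toList ≠ [] := by
    rw [Ne, Finset.toList_eq_nil]
    exact Finset.Nonempty.ne_empty ⟨p.1, Finset.mem_univ _⟩
  obtain ⟨h1, h2⟩ := run_innerCode c p.1 p.2 _ hl
  rw [entryCode, run_append, run_singleton, exec]
  simp [h1, entryVal]

/-- Entry code writes only `q` registers, and the entry values depend only on the other registers.
The in-place sweep therefore uses the previous `val` table for every pair. -/
lemma run_flatMap_entryCode (c : Machine S G) (l : List (S × G)) :
    (∀ p ∈ l, (run c (l.flatMap entryCode)).mem (.q p.1 p.2) = entryVal c p) ∧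
      ∀ r, (∀ p ∈ l, r ≠ .q p.1 p.2) → (run c (l.flatMap entryCode)).mem r = c.mem r := by
  induction l using List.reverseRecOn with
  | nil => simp [run]
  | append_singleton l a ih =>
    rw [List.flatMap_append, List.flatMap_singleton, run_append, run_entryCode]
    obtain ⟨h1, h2⟩ := ih
    set d := run c (l.flatMap entryCode)
    have he : entryVal d a = entryVal c a := by
      simp only [entryVal]
      rw [h2 .disc (by simp), h2 (.rew _ _) (by simp)]
      simp only [h2 (.trans _ _ _) (by simp), h2 (.val _) (by simp)]
    rw [he]
    refine ⟨fun p hp => ?_, fun r hr => ?_⟩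
    · by_cases hpa : p = a
      · rw [hpa, Function.update_self]
      · rw [Function.update_of_ne, h1 p (by simpa [hpa] using hp)]
        simpa [Prod.ext_iff] using hpa
    · rw [Function.update_of_ne (hr a (by simp)), h2 r fun p hp => hr p (by simp [hp])]

variable [Fintype G]

/-- The configuration after `t` iterations. -/
structure IsIterate (P : S → G → S → ℝ) (R : S → G → ℝ) (γ : ℝ) (t : ℕ) (c : Machine S G) :
    Prop where
  disc : c.mem .disc = γ
  trans : ∀ s h s', c.mem (.trans s h s') = P s h s'
  rew : ∀ s h, c.mem (.rew s h) = R s h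
  val : ∀ s, c.mem (.val s) = ⨆ h, qIter P R γ t s h
  greedy : IsGreedy (qIter P R γ t) c.policy

variable {P : S → G → S → ℝ} {R : S → G → ℝ} {γ : ℝ}

lemma IsIterate.run_sweepCode [Nonempty G] {t : ℕ} {c : Machine S G} (hc : IsIterate P R γ t c) :
    IsIterate P R γ (t + 1) (run c (sweepCode S G)) := by
  rw [sweepCode_eq, run_append]
  obtain ⟨h1, h2⟩ := run_flatMap_entryCode c
    ((Finset.univ : Finset S).toList ×ˢ (Finset.univ : Finset G).toList)
  set d := run c (((Finset.univ : Finset S).toList ×ˢ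
    (Finset.univ : Finset G).toList).flatMap entryCode)
  have hq (s h) : d.mem (.q s h) = qIter P R γ (t + 1) s h := by
    rw [h1 (s, h) (List.pair_mem_product.2 (by simp)), entryVal, hc.disc, hc.rew]
    simp only [hc.trans, hc.val, qIter]
    ring
  have hk : (Finset.univ : Finset G).toList ≠ [] := by
    rw [Ne, Finset.toList_eq_nil]
    exact Finset.univ_nonempty.ne_empty
  obtain ⟨k1, k2⟩ := run_flatMap_maxCode d _ hk (Finset.univ : Finset S).toList
  set e := run d ((Finset.univ : Finset S).toList.flatMap
    fun s => maxCode s (Finset.univ : Finset G).toList)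
  simp only [Finset.mem_toList, Finset.mem_univ, forall_const, hq] at k2
  have hg : IsGreedy (qIter P R γ (t + 1)) e.policy := fun s h => (k2 s).1 ▸ (k2 s).2 h
  refine ⟨?_, fun s h s' => ?_, fun s h => ?_, fun s => ?_, hg⟩
  · rw [k1 _ (by simp), h2 _ (by simp), hc.disc]
  · rw [k1 _ (by simp), h2 _ (by simp), hc.trans]
  · rw [k1 _ (by simp), h2 _ (by simp), hc.rew]
  · rw [(k2 s).1]
    exact le_antisymm
      (le_ciSup (f := fun h => qIter P R γ (t + 1) s h) (Set.finite_range _).bddAbove _)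
      (ciSup_le (hg s))

lemma isIterate_runVI [Nonempty G] (ρ₀ : S → G) (T : ℕ) :
    IsIterate P R γ T (runVI P R γ ρ₀ T) := by
  induction T with
  -- All entries of the initial table are zero, so any initial policy register is greedy.
  | zero => exact ⟨rfl, fun _ _ _ => rfl, fun _ _ => rfl, fun _ => by simp [runVI, viCode, run,
      initial, qIter], fun _ _ => le_rfl⟩
  | succ T ih =>
    have : runVI P R γ ρ₀ (T + 1) = run (runVI P R γ ρ₀ T) (sweepCode S G) := by
      rw [runVI, viCode, List.replicate_succ', List.flatten_append, run_append]
      simp [runVI, viCode]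
    rw [this]
    exact ih.run_sweepCode

end MachineFintype

section ProgramLength

variable {S G : Type*}

lemma length_innerCode (s : S) (h : G) (l : List S) : (innerCode s h l).length = l.length := by
  cases l <;> simp [innerCode]

lemma length_maxCode (s : S) (l : List G) : (maxCode s l).length = l.length := by
  cases l <;> simp [maxCode]

/-- Each of the `S * G` entries costs `S` instructions for the inner product and one for discount
and reward; the maxima cost `S * G` more. -/
lemma length_viCode [Fintype S] [Fintype G] (T : ℕ) : (viCode S G T).length
    = (Fintype.card S ^ 2 * Fintype.card G + 2 * Fintype.card S * Fintype.card G) * T := by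
  simp only [viCode, List.length_flatten, List.map_replicate, List.sum_replicate, smul_eq_mul,
    sweepCode, List.length_append, List.length_flatMap, length_innerCode, length_maxCode,
    Finset.length_toList, Finset.card_univ, List.map_const', List.length_cons, List.length_nil]
  ring

lemma runVI_steps [Fintype S] [Fintype G] [DecidableEq S] [DecidableEq G] (P : S → G → S → ℝ)
    (R : S → G → ℝ) (γ : ℝ) (ρ₀ : S → G) (T : ℕ) : (runVI P R γ ρ₀ T).steps
    = (Fintype.card S ^ 2 * Fintype.card G + 2 * Fintype.card S * Fintype.card G) * T := by
  rw [runVI, run_steps, length_viCode]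
  exact Nat.zero_add _

end ProgramLength

/-! ### Bellman equation for the value of a policy -/

section StepOp

variable {S A : Type*} [Fintype S] [Fintype A]

/-- The one-step expectation operator on functions of state-action pairs. -/
def stepOp (M : MDP S A) (π : Policy S A) (f : S × A → ℝ) (z : S × A) : ℝ :=
  ∑ s', M.P z.1 z.2 s' * ∑ a', π s' a' * f (s', a')

lemma stepOp_mem_Icc (M : MDP S A) (π : Policy S A) {f : S × A → ℝ} {a b : ℝ}
    (hf : ∀ z, f z ∈ Set.Icc a b) (z : S × A) : stepOp M π f z ∈ Set.Icc a b :=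
  sum_mul_mem_Icc (M.P_mem _ _) fun s' => sum_mul_mem_Icc (π s').2 fun a' => hf (s', a')

lemma iterate_stepOp_mem_Icc (M : MDP S A) (π : Policy S A) {f : S × A → ℝ} {a b : ℝ}
    (hf : ∀ z, f z ∈ Set.Icc a b) (t : ℕ) (z : S × A) : (stepOp M π)^[t] f z ∈ Set.Icc a b := by
  induction t generalizing f with
  | zero => exact hf z
  | succ t ih => exact ih (stepOp_mem_Icc M π hf)

lemma summable_iterate_stepOp {M : MDP S A} (hR : ∀ s a, 0 ≤ M.R s a ∧ M.R s a ≤ 1)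
    (π : Policy S A) (z : S × A) :
    Summable fun t : ℕ => M.γ ^ t * (stepOp M π)^[t] (fun z => M.R z.1 z.2) z := by
  refine Summable.of_norm_bounded (summable_geometric_of_lt_one M.γ_nonneg M.γ_lt_one)
    fun t => ?_
  have h := iterate_stepOp_mem_Icc M π (f := fun z => M.R z.1 z.2) (fun z => hR z.1 z.2) t z
  rw [Real.norm_eq_abs, abs_of_nonneg (mul_nonneg (pow_nonneg M.γ_nonneg _) h.1)]
  exact mul_le_of_le_one_right (pow_nonneg M.γ_nonneg _) h.2

end StepOp

section Trajectory

variable {S A : Type*} [Fintype S] [Fintype A] [MeasurableSpace S] [MeasurableSingletonClass S]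
  [MeasurableSpace A] [MeasurableSingletonClass A]

lemma stepPMF_integral (M : MDP S A) (π : Policy S A) (z : S × A) (f : S × A → ℝ) :
    ∫ z', f z' ∂(M.stepKernel π z)
      = ∑ s', M.P z.1 z.2 s' * ∑ a', π s' a' * f (s', a') := by
  change ∫ z', f z' ∂(M.stepPMF π z).toMeasure = _
  rw [PMF.integral_eq_sum, Fintype.sum_prod_type]
  refine Finset.sum_congr rfl fun s' _ => ?_
  rw [Finset.mul_sum]
  refine Finset.sum_congr rfl fun a' _ => ?_
  rw [MDP.stepPMF, PMF.ofFintype_apply, ENNReal.toReal_ofReal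
    (by exact mul_nonneg ((M.P_mem z.1 z.2).1 s') ((π s').2.1 a')), smul_eq_mul, mul_assoc]

instance (M : MDP S A) (π : Policy S A) (z : S × A) : IsProbabilityMeasure (M.trajectory π z) :=
  inferInstanceAs (IsProbabilityMeasure (Kernel.traj (X := fun _ => S × A) _ 0 _))

lemma integrable_coord (M : MDP S A) (π : Policy S A) (z : S × A) (t : ℕ) (f : S × A → ℝ) :
    Integrable (fun τ => f (τ t)) (M.trajectory π z) := by
  obtain ⟨C, hC⟩ := (Set.finite_range fun z => ‖f z‖).bddAbove
  exact Integrable.of_bound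
    ((measurable_of_countable f).comp (measurable_pi_apply t)).aestronglyMeasurable C
    (.of_forall fun τ => hC ⟨τ t, rfl⟩)

/-- The Markov property: condition on the history up to time `t`, given which the next pair has law
`historyKernel`. -/
lemma integral_trajectory_succ (M : MDP S A) (π : Policy S A) (z : S × A) (t : ℕ)
    (f : S × A → ℝ) :
    ∫ τ, f (τ (t + 1)) ∂(M.trajectory π z) = ∫ τ, stepOp M π f (τ t) ∂(M.trajectory π z) := by
  have hm (f : S × A → ℝ) (t : ℕ) : Measurable fun τ : ℕ → S × A => f (τ t) :=
    (measurable_of_countable f).comp (measurable_pi_apply t)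
  unfold MDP.trajectory
  rw [← Kernel.integral_traj_partialTraj (Nat.zero_le t) (integrable_coord M π z (t + 1) f)]
  have h1 : ∀ x, ∫ τ, f (τ (t + 1)) ∂(Kernel.traj (X := fun _ => S × A) (M.historyKernel π) t x)
      = stepOp M π f (x ⟨t, Finset.mem_Iic.2 le_rfl⟩) := by
    intro x
    have : (Kernel.traj (X := fun _ => S × A) (M.historyKernel π) t x).map (fun τ => τ (t + 1))
        = M.historyKernel π t x := by
      rw [← Kernel.map_traj_succ_self (X := fun _ => S × A) (κ := M.historyKernel π),
        Kernel.map_apply _ (measurable_pi_apply _)]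
    rw [← integral_map (φ := fun τ : ℕ → S × A => τ (t + 1)) (f := f)
      (measurable_pi_apply _).aemeasurable (measurable_of_countable f).aestronglyMeasurable, this]
    exact stepPMF_integral M π _ f
  simp only [h1]
  rw [← Kernel.traj_map_frestrictLe_apply, integral_map]
  · rfl
  · exact (Preorder.measurable_frestrictLe _).aemeasurable
  · exact ((measurable_of_countable (stepOp M π f)).comp
      (measurable_pi_apply _)).aestronglyMeasurable

lemma integral_trajectory_zero (M : MDP S A) (π : Policy S A) (z : S × A) (f : S × A → ℝ) :
    ∫ τ, f (τ 0) ∂(M.trajectory π z) = f z := by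
  unfold MDP.trajectory
  have h : ∫ τ, f (τ 0) ∂(Kernel.traj (X := fun _ => S × A) (M.historyKernel π) 0 fun _ => z)
      = ∫ x, f (x ⟨0, Finset.mem_Iic.2 le_rfl⟩)
        ∂((Kernel.traj (X := fun _ => S × A) (M.historyKernel π) 0 fun _ => z).map
          (Preorder.frestrictLe 0)) := by
    have hm : Measurable fun x : Finset.Iic 0 → S × A => f (x ⟨0, Finset.mem_Iic.2 le_rfl⟩) :=
      (measurable_of_countable f).comp (measurable_pi_apply _)
    exact (integral_map (φ := Preorder.frestrictLe (π := fun _ => S × A) 0)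
      (f := fun x => f (x ⟨0, Finset.mem_Iic.2 le_rfl⟩))
      (Preorder.measurable_frestrictLe _).aemeasurable
      hm.aestronglyMeasurable).symm
  rw [h, Kernel.traj_map_frestrictLe_apply, Kernel.partialTraj_self, Kernel.id_apply,
    integral_dirac]

lemma integral_trajectory_eq_iterate (M : MDP S A) (π : Policy S A) (z : S × A) (t : ℕ)
    (f : S × A → ℝ) :
    ∫ τ, f (τ t) ∂(M.trajectory π z) = (stepOp M π)^[t] f z := by
  induction t generalizing f with
  | zero => exact integral_trajectory_zero M π z f
  | succ t ih => rw [integral_trajectory_succ, ih, Function.iterate_succ_apply]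

variable {M : MDP S A}

/-- Sum and expectation commute because the terms are dominated by a geometric series. -/
lemma Q_eq_tsum (hR : ∀ s a, 0 ≤ M.R s a ∧ M.R s a ≤ 1) (π : Policy S A) (s : S) (a : A) :
    M.Q π s a = ∑' t : ℕ, M.γ ^ t * (stepOp M π)^[t] (fun z => M.R z.1 z.2) (s, a) := by
  unfold MDP.Q
  have hint (t : ℕ) : Integrable (fun τ : ℕ → S × A => M.γ ^ t * M.R (τ t).1 (τ t).2)
      (M.trajectory π (s, a)) :=
    (integrable_coord M π (s, a) t fun z => M.R z.1 z.2).const_mul _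
  have hb (t : ℕ) (τ : ℕ → S × A) : ‖M.γ ^ t * M.R (τ t).1 (τ t).2‖ ≤ M.γ ^ t := by
    have h := hR (τ t).1 (τ t).2
    rw [Real.norm_eq_abs, abs_of_nonneg (mul_nonneg (pow_nonneg M.γ_nonneg _) h.1)]
    exact mul_le_of_le_one_right (pow_nonneg M.γ_nonneg _) h.2
  rw [← integral_tsum_of_summable_integral_norm hint]
  · refine tsum_congr fun t => ?_
    rw [integral_const_mul,
      integral_trajectory_eq_iterate M π (s, a) t (fun z => M.R z.1 z.2)]
  · refine Summable.of_nonneg_of_le (fun t => integral_nonneg fun _ => norm_nonneg _) (fun t => ?_)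
      (summable_geometric_of_lt_one M.γ_nonneg M.γ_lt_one)
    refine (integral_mono (hint t).norm (integrable_const _) (hb t)).trans_eq ?_
    simp

lemma Q_eq (hR : ∀ s a, 0 ≤ M.R s a ∧ M.R s a ≤ 1) (π : Policy S A) (s : S) (a : A) :
    M.Q π s a = M.R s a + M.γ * ∑ s', M.P s a s' * M.V π s' := by
  have hs := summable_iterate_stepOp hR π
  rw [Q_eq_tsum hR, (hs (s, a)).tsum_eq_zero_add]
  congr 1
  · simp
  have h1 (t : ℕ) : M.γ ^ (t + 1) * (stepOp M π)^[t + 1] (fun z => M.R z.1 z.2) (s, a)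
      = ∑ s', ∑ a', M.γ * (M.P s a s' * (π s' a' *
          (M.γ ^ t * (stepOp M π)^[t] (fun z => M.R z.1 z.2) (s', a')))) := by
    rw [Function.iterate_succ_apply', stepOp, Finset.mul_sum]
    refine Finset.sum_congr rfl fun s' _ => ?_
    rw [Finset.mul_sum, Finset.mul_sum]
    exact Finset.sum_congr rfl fun a' _ => by ring
  have hs' (s' : S) (a' : A) : Summable fun t : ℕ => M.γ * (M.P s a s' * (π s' a' *
      (M.γ ^ t * (stepOp M π)^[t] (fun z => M.R z.1 z.2) (s', a')))) :=
    (((hs (s', a')).mul_left _).mul_left _).mul_left _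
  simp only [h1]
  rw [Summable.tsum_finsetSum fun s' _ => summable_sum fun a' _ => hs' s' a', Finset.mul_sum]
  refine Finset.sum_congr rfl fun s' _ => ?_
  rw [Summable.tsum_finsetSum fun a' _ => hs' s' a', MDP.V, Finset.mul_sum, Finset.mul_sum]
  refine Finset.sum_congr rfl fun a' _ => ?_
  rw [tsum_mul_left, tsum_mul_left, tsum_mul_left, Q_eq_tsum hR]

/-- Bellman equation for the value of a stationary policy. -/
lemma V_eq (hR : ∀ s a, 0 ≤ M.R s a ∧ M.R s a ≤ 1) (π : Policy S A) (s : S) :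
    M.V π s = ∑ a, π s a * (M.R s a + M.γ * ∑ s', M.P s a s' * M.V π s') := by
  conv_lhs => rw [MDP.V]
  simp only [Q_eq hR]

end Trajectory

/-! ### Bernstein's inequality for samples from a finite type -/

section Bernstein

variable {S Ω : Type*} [Fintype S] [MeasurableSpace S] [MeasurableSingletonClass S]
  [MeasurableSpace Ω] {μ : Measure Ω} [IsProbabilityMeasure μ]

lemma integral_comp_eq_sum {X : Ω → S} (hX : Measurable X) {p : S → ℝ}
    (hlaw : ∀ s, μ.real {ω | X ω = s} = p s) (f : S → ℝ) :
    ∫ ω, f (X ω) ∂μ = ∑ s, p s * f s := by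
  have := Measure.isProbabilityMeasure_map (μ := μ) hX.aemeasurable
  rw [← integral_map hX.aemeasurable (measurable_of_countable f).aestronglyMeasurable,
    integral_fintype .of_finite]
  refine Finset.sum_congr rfl fun s _ => ?_
  rw [← hlaw, map_measureReal_apply hX (measurableSet_singleton s), smul_eq_mul]
  rfl

lemma integrable_comp {X : Ω → S} (hX : Measurable X) (f : S → ℝ) :
    Integrable (fun ω => f (X ω)) μ := by
  obtain ⟨C, hC⟩ := (Set.finite_range fun z => ‖f z‖).bddAbove
  exact Integrable.of_bound ((measurable_of_countable f).comp hX).aestronglyMeasurable C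
    (.of_forall fun ω => hC ⟨X ω, rfl⟩)

/-- Use `exp x ≤ 1 + x + x ^ 2` for `|x| ≤ 1`; centring kills the linear term. -/
lemma mgf_le_exp_wvar {X : Ω → S} (hX : Measurable X) {p : S → ℝ} (hp : p ∈ stdSimplex ℝ S)
    (hlaw : ∀ s, μ.real {ω | X ω = s} = p s) {f : S → ℝ} {b l : ℝ}
    (hf : ∀ s, |f s - ∑ s', p s' * f s'| ≤ b) (hl : 0 ≤ l) (hlb : l * b ≤ 1) :
    mgf (fun ω => f (X ω) - ∑ s', p s' * f s') μ l ≤ Real.exp (l ^ 2 * wvar p f) := by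
  set e := ∑ s', p s' * f s' with he
  rw [mgf, integral_comp_eq_sum hX hlaw fun s => Real.exp (l * (f s - e))]
  have h1 : ∀ s, Real.exp (l * (f s - e)) ≤ 1 + l * (f s - e) + (l * (f s - e)) ^ 2 := by
    intro s
    have : |l * (f s - e)| ≤ 1 := by
      rw [abs_mul, abs_of_nonneg hl]
      exact (mul_le_mul_of_nonneg_left (hf s) hl).trans hlb
    linarith [(abs_le.1 (Real.abs_exp_sub_one_sub_id_le this)).2]
  refine (sum_mul_mono hp h1).trans ?_
  have h2 : ∑ s, p s * (1 + l * (f s - e) + (l * (f s - e)) ^ 2) = l ^ 2 * wvar p f + 1 := by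
    have h3 : ∀ s, p s * (1 + l * (f s - e) + (l * (f s - e)) ^ 2)
        = l ^ 2 * (p s * (f s - e) ^ 2) + (l * (p s * f s) + p s * (1 - l * e)) :=
      fun s => by ring
    simp only [h3, Finset.sum_add_distrib, ← Finset.mul_sum, sum_mul_const hp, ← he]
    rw [wvar, ← he]
    ring
  rw [h2]
  exact Real.add_one_le_exp _

variable {m : ℕ} {X : Fin m → Ω → S} {p : S → ℝ} {b t : ℝ}

lemma bernstein_upper_tail (hX : ∀ k, Measurable (X k)) (hind : iIndepFun X μ)
    (hp : p ∈ stdSimplex ℝ S) (hlaw : ∀ k s, μ.real {ω | X k ω = s} = p s) {f : S → ℝ}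
    (hf : ∀ s, |f s - ∑ s', p s' * f s'| ≤ b) (hb : 0 < b) (ht : 0 ≤ t) :
    μ.real {ω | 2 * √(m * wvar p f * t) + b * t ≤ ∑ k, (f (X k ω) - ∑ s', p s' * f s')}
      ≤ Real.exp (-t) := by
  set e := ∑ s', p s' * f s' with he
  have hv := wvar_nonneg hp f
  set v := wvar p f with hvdef
  set D := √(m * v * t) with hD
  have hD0 : 0 ≤ D := Real.sqrt_nonneg _
  have hmv : 0 ≤ m * v := by positivity
  have key (l : ℝ) (hl : 0 ≤ l) (hlb : l * b ≤ 1) :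
      μ.real {ω | 2 * D + b * t ≤ ∑ k, (f (X k ω) - e)}
        ≤ Real.exp (-l * (2 * D + b * t) + m * (l ^ 2 * v)) := by
    have hi : iIndepFun (fun k ω => f (X k ω) - e) μ :=
      hind.comp (fun _ s => f s - e) fun _ => measurable_of_countable _
    have hm (k) : Measurable fun ω => f (X k ω) - e :=
      (measurable_of_countable fun s => f s - e).comp (hX k)
    have h1 := measure_ge_le_exp_mul_mgf (μ := μ) (X := ∑ k, fun ω => f (X k ω) - e)
      (2 * D + b * t) hl (by
        have := hi.integrable_exp_mul_sum hm (t := l) (s := Finset.univ)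
          (fun k _ => integrable_comp (hX k) fun s => Real.exp (l * (f s - e)))
        exact this)
    rw [hi.mgf_sum hm] at h1
    simp only [Finset.sum_apply] at h1
    refine h1.trans ?_
    rw [Real.exp_add]
    refine mul_le_mul_of_nonneg_left ?_ (Real.exp_nonneg _)
    refine (Finset.prod_le_prod (fun _ _ => mgf_nonneg)
      fun k _ => mgf_le_exp_wvar (hX k) hp (hlaw k) hf hl hlb).trans_eq ?_
    rw [Finset.prod_const, Finset.card_univ, Fintype.card_fin, ← Real.exp_nat_mul]
  -- Chernoff's bound with `l = √(t / (m * v))` when this respects `l * b ≤ 1`, and with `l = 1 / b`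
  -- otherwise. The second case includes zero variance.
  by_cases h : 0 < m * v ∧ t * b ^ 2 ≤ m * v
  · obtain ⟨h0, h1⟩ := h
    refine (key (√(t / (m * v))) (Real.sqrt_nonneg _) ?_).trans (Real.exp_le_exp.2 ?_)
    · rw [← Real.sqrt_sq hb.le, ← Real.sqrt_mul (by positivity), Real.sqrt_le_one]
      rw [div_mul_eq_mul_div]
      exact div_le_one_of_le₀ h1 hmv
    · have h2 : √(t / (m * v)) * D = t := by
        rw [hD, ← Real.sqrt_mul (by positivity)]
        rw [← mul_assoc, div_mul_cancel₀ _ h0.ne', ← sq, Real.sqrt_sq ht]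
      have h3 : m * (√(t / (m * v)) ^ 2 * v) = t := by
        rw [Real.sq_sqrt (by positivity),
          show m * (t / (m * v) * v) = (m * v) * (t / (m * v)) by ring, mul_div_cancel₀ _ h0.ne']
      have h4 : 0 ≤ √(t / (m * v)) * (b * t) := by positivity
      linarith
  · have h1 : m * v ≤ t * b ^ 2 := by
      rcases hmv.eq_or_lt with h0 | h0
      · rw [← h0]; positivity
      · exact (not_le.1 fun h2 => h ⟨h0, h2⟩).le
    refine (key b⁻¹ (by positivity) (by rw [inv_mul_cancel₀ hb.ne'])).trans (Real.exp_le_exp.2 ?_)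
    have h2 : m * v ≤ D * b := by
      rw [hD, ← Real.sqrt_sq hb.le, ← Real.sqrt_mul (by positivity)]
      refine Real.le_sqrt_of_sq_le ?_
      nlinarith [mul_le_mul_of_nonneg_left h1 hmv]
    have h3 : m * (b⁻¹ ^ 2 * v) ≤ b⁻¹ * D := by
      have := mul_le_mul_of_nonneg_left h2 (show 0 ≤ b⁻¹ ^ 2 by positivity)
      calc _ = b⁻¹ ^ 2 * (m * v) := by ring
        _ ≤ b⁻¹ ^ 2 * (D * b) := this
        _ = b⁻¹ * D := by field_simp
    have h4 : b⁻¹ * (b * t) = t := by field_simp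
    have h5 : 0 ≤ b⁻¹ * D := by positivity
    linarith

/-- Bernstein's inequality for the empirical mean of `m` independent samples. -/
theorem bernstein (hm : 0 < m) (hX : ∀ k, Measurable (X k)) (hind : iIndepFun X μ)
    (hp : p ∈ stdSimplex ℝ S) (hlaw : ∀ k s, μ.real {ω | X k ω = s} = p s) {f : S → ℝ}
    (hf : ∀ s, f s ∈ Set.Icc 0 b) (hb : 0 < b) (ht : 0 ≤ t) :
    μ.real {ω | 2 * √(t / m) * √(wvar p f) + b * (t / m)
        < |(∑ k, f (X k ω)) / m - ∑ s, p s * f s|} ≤ 2 * Real.exp (-t) := by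
  have hm' : (0 : ℝ) < m := Nat.cast_pos.2 hm
  have hv := wvar_nonneg hp f
  have hmean := sum_mul_mem_Icc hp hf
  have hf' : ∀ s, |f s - ∑ s', p s' * f s'| ≤ b := fun s =>
    abs_sub_le_iff.2 ⟨by linarith [(hf s).2, hmean.1], by linarith [(hf s).1, hmean.2]⟩
  have hneg : ∑ s', p s' * -f s' = -∑ s', p s' * f s' := by
    simp only [mul_neg, Finset.sum_neg_distrib]
  have hwneg : wvar p (fun s => -f s) = wvar p f := by
    simp only [wvar, hneg]
    exact Finset.sum_congr rfl fun _ _ => by ring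
  -- The two tails are the upper tails of `f` and `-f`, which have the same variance.
  have h1 := bernstein_upper_tail hX hind hp hlaw hf' hb ht
  have h2 := bernstein_upper_tail (f := fun s => -f s) hX hind hp hlaw
    (fun s => by rw [hneg, ← abs_neg]; convert! hf' s using 2; ring) hb ht
  rw [hwneg] at h2
  simp only [hneg] at h2
  have hD : √(m * wvar p f * t) = m * (√(t / m) * √(wvar p f)) := by
    rw [← Real.sqrt_mul (by positivity),
      show m * wvar p f * t = m ^ 2 * (t / m * wvar p f) by field_simp,
      Real.sqrt_mul (by positivity), Real.sqrt_sq hm'.le]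
  refine (measureReal_mono (s₂ := {ω | 2 * √(m * wvar p f * t) + b * t
      ≤ ∑ k, (f (X k ω) - ∑ s', p s' * f s')} ∪ {ω | 2 * √(m * wvar p f * t) + b * t
      ≤ ∑ k, (-f (X k ω) - -∑ s', p s' * f s')}) (fun ω hω => ?_)).trans
    ((measureReal_union_le _ _).trans ((add_le_add h1 h2).trans_eq (two_mul _).symm))
  have hω' : 2 * √(t / m) * √(wvar p f) + b * (t / m)
        < |(∑ k, f (X k ω)) / m - ∑ s, p s * f s| := hω
  have e1 : 2 * √(m * wvar p f * t) + b * t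
      = m * (2 * √(t / m) * √(wvar p f) + b * (t / m)) := by
    rw [hD]; field_simp
  have e2 : (∑ k, f (X k ω)) / m * m = ∑ k, f (X k ω) := by field_simp
  rcases lt_abs.1 hω' with h | h
  · left
    simp only [Set.mem_ofPred_eq, Finset.sum_sub_distrib, Finset.sum_const, Finset.card_univ,
      Fintype.card_fin, nsmul_eq_mul]
    rw [e1]
    nlinarith [mul_lt_mul_of_pos_left h hm']
  · right
    simp only [Set.mem_ofPred_eq, Finset.sum_sub_distrib, Finset.sum_const, Finset.card_univ,
      Fintype.card_fin, nsmul_eq_mul, Finset.sum_neg_distrib]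
    rw [e1]
    nlinarith [mul_lt_mul_of_pos_left h hm']

end Bernstein

/-! ### Bad sets chosen by an independent variable -/

section Conditioning

variable {Ω α β : Type*} [MeasurableSpace Ω] {μ : Measure Ω} [IsProbabilityMeasure μ]
  [Fintype α] [MeasurableSpace α] [MeasurableSingletonClass α] [MeasurableSpace β]

/-- A bound on the probability that `Z` lies in a bad set, uniform over the choice of the set,
remains valid if the set is chosen according to an independent variable. -/
lemma measureReal_mem_le_of_indepFun {Y : Ω → α} {Z : Ω → β} (h : IndepFun Y Z μ)
    (hY : Measurable Y) {bad : α → Set β} (hbad : ∀ y, MeasurableSet (bad y)) {ε : ℝ}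
    (hε : ∀ y, μ.real (Z ⁻¹' bad y) ≤ ε) : μ.real {ω | Z ω ∈ bad (Y ω)} ≤ ε := by
  have hsum : ∑ y, μ.real (Y ⁻¹' {y}) = 1 := by
    have := Measure.isProbabilityMeasure_map (μ := μ) hY.aemeasurable
    have h1 := integral_comp_eq_sum (μ := μ) (X := Y) hY (fun _ => rfl) fun _ => 1
    simp only [integral_const, mul_one, smul_eq_mul, probReal_univ] at h1
    exact h1.symm
  have hsub : {ω | Z ω ∈ bad (Y ω)} ⊆ ⋃ y, Y ⁻¹' {y} ∩ Z ⁻¹' bad y := fun ω hω =>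
    Set.mem_iUnion.2 ⟨Y ω, rfl, hω⟩
  calc μ.real {ω | Z ω ∈ bad (Y ω)} ≤ μ.real (⋃ y, Y ⁻¹' {y} ∩ Z ⁻¹' bad y) :=
        measureReal_mono hsub
    _ ≤ ∑ y, μ.real (Y ⁻¹' {y} ∩ Z ⁻¹' bad y) := measureReal_iUnion_fintype_le _
    _ = ∑ y, μ.real (Y ⁻¹' {y}) * μ.real (Z ⁻¹' bad y) := by
        refine Finset.sum_congr rfl fun y _ => ?_
        simp only [measureReal_def]
        rw [h.measure_inter_preimage_eq_mul _ _ (measurableSet_singleton y) (hbad y),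
          ENNReal.toReal_mul]
    _ ≤ ∑ y, μ.real (Y ⁻¹' {y}) * ε :=
        Finset.sum_le_sum fun y _ => mul_le_mul_of_nonneg_left (hε y) measureReal_nonneg
    _ = ε := by rw [← Finset.sum_mul, hsum, one_mul]

end Conditioning

/-! ### Deviation of the empirical model on leave-one-state-out value functions -/

section Empirical

variable {S G : Type*} [DecidableEq S] {m : ℕ}

lemma empP_mem [Fintype S] (hm : 0 < m) (x : S × G × Fin m → S) (s : S) (h : G) :
    empP x s h ∈ stdSimplex ℝ S := by
  have hm' : (m : ℝ) ≠ 0 := Nat.cast_ne_zero.2 hm.ne'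
  refine ⟨fun s' => by unfold empP; positivity, ?_⟩
  simp only [empP]
  rw [← Finset.sum_div, ← Nat.cast_sum,
    ← Finset.card_eq_sum_card_fiberwise fun _ _ => Finset.mem_univ _]
  simp [hm']

lemma sum_empP_mul [Fintype S] (x : S × G × Fin m → S) (s : S) (h : G) (f : S → ℝ) :
    ∑ s', empP x s h s' * f s' = (∑ k, f (x (s, h, k))) / m := by
  simp only [empP]
  rw [← Finset.sum_fiberwise Finset.univ (fun k => x (s, h, k)) fun k => f (x (s, h, k)),
    Finset.sum_div]
  refine Finset.sum_congr rfl fun s' _ => ?_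
  rw [Finset.sum_congr rfl fun k hk => by rw [(Finset.mem_filter.1 hk).2], Finset.sum_const,
    nsmul_eq_mul]
  ring

variable {Ω : Type*} [Fintype S] [MeasurableSpace S] [MeasurableSingletonClass S] [Fintype G]
  [MeasurableSpace Ω] {μ : Measure Ω} [IsProbabilityMeasure μ]

/-- Bernstein's inequality for the empirical transition probabilities at `s`, evaluated on a
function that depends only on the samples drawn at other states. -/
lemma bernstein_empP (hm : 0 < m) {X : S × G × Fin m → Ω → S} (hX : ∀ i, Measurable (X i))
    (hind : iIndepFun X μ) {P : S → G → S → ℝ} (hP : ∀ s h, P s h ∈ stdSimplex ℝ S)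
    (hlaw : ∀ s h k s', μ.real {ω | X (s, h, k) ω = s'} = P s h s') (s : S) (h : G)
    {Φ : (S × G × Fin m → S) → S → ℝ} {b t : ℝ} (hb : 0 < b) (ht : 0 ≤ t)
    (hΦ : ∀ x s', Φ x s' ∈ Set.Icc 0 b)
    (hΦs : ∀ x x' : S × G × Fin m → S, (∀ i, i.1 ≠ s → x i = x' i) → Φ x = Φ x') :
    μ.real {ω | 2 * √(t / m) * √(wvar (P s h) (Φ fun i => X i ω)) + b * (t / m)
        < |∑ s', empP (fun i => X i ω) s h s' * Φ (fun i => X i ω) s'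
          - ∑ s', P s h s' * Φ (fun i => X i ω) s'|} ≤ 2 * Real.exp (-t) := by
  classical
  set F₁ : Finset (S × G × Fin m) := Finset.univ.filter fun i => i.1 ≠ s
  set F₂ : Finset (S × G × Fin m) := Finset.univ.filter fun i => i.1 = s
  have hdis : Disjoint F₁ F₂ := Finset.disjoint_filter.2 fun _ _ h1 h2 => h1 h2
  have hmem (k : Fin m) : (s, h, k) ∈ F₂ := by simp [F₂]
  -- Missing samples at `s` are filled with an arbitrary value; `Φ` does not see them. Hence `Φ` is
  -- a function of the `F₁` samples, which are independent of the `F₂` samples.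
  set ext : (F₁ → S) → S × G × Fin m → S := fun y i => if hi : i ∈ F₁ then y ⟨i, hi⟩ else s
  have hext (ω : Ω) : Φ (ext fun i => X i ω) = Φ fun i => X i ω := hΦs _ _ fun i hi => by
    simp only [ext]
    rw [dif_pos (by simpa [F₁] using hi)]
  have hmain := measureReal_mem_le_of_indepFun (hind.indepFun_finset F₁ F₂ hdis hX)
    (measurable_pi_lambda _ fun i => hX i)
    (bad := fun y => {z | 2 * √(t / m) * √(wvar (P s h) (Φ (ext y))) + b * (t / m)
      < |(∑ k, Φ (ext y) (z ⟨(s, h, k), hmem k⟩)) / m - ∑ s', P s h s' * Φ (ext y) s'|})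
    (fun y => Set.Finite.measurableSet (Set.toFinite _)) (ε := 2 * Real.exp (-t))
    fun y => by
      have hinj : Function.Injective fun k : Fin m => (s, h, k) := fun a b hab => by
        simpa using hab
      exact bernstein hm (X := fun k => X (s, h, k)) (fun k => hX _) (hind.precomp hinj) (hP s h)
        (fun k => hlaw s h k) (hΦ (ext y)) hb ht
  refine (measureReal_mono fun ω hω => ?_).trans hmain
  simp only [Set.mem_ofPred_eq, sum_empP_mul] at hω ⊢
  rw [hext ω]
  exact hω

end Empirical

/-! ### Making one state absorbing -/

section Absorbing

variable {S G : Type*} [DecidableEq S]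

/-- Transition probabilities in which the state `s₀` is made absorbing. -/
def absorbP (P : S → G → S → ℝ) (s₀ : S) : S → G → S → ℝ :=
  fun s h => if s = s₀ then Pi.single s₀ 1 else P s h

/-- Rewards which give the absorbing state `s₀` the value `u`. -/
def absorbR (R : S → G → ℝ) (γ : ℝ) (s₀ : S) (u : ℝ) : S → G → ℝ :=
  fun s h => if s = s₀ then (1 - γ) * u else R s h

variable {P : S → G → S → ℝ} {R : S → G → ℝ} {γ : ℝ}

lemma absorbP_congr {P' : S → G → S → ℝ} {s₀ : S} (h : ∀ s, s ≠ s₀ → P s = P' s) :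
    absorbP P s₀ = absorbP P' s₀ := by
  funext s a
  unfold absorbP
  split_ifs with hs
  · rfl
  · rw [h s hs]

lemma absorbR_mem_Icc (hR : ∀ s h, R s h ∈ Set.Icc 0 1) (h1 : γ < 1) {s₀ : S} {u : ℝ}
    (hu : u ∈ Set.Icc 0 (1 / (1 - γ))) (s : S) (h : G) :
    absorbR R γ s₀ u s h ∈ Set.Icc 0 1 := by
  have hg : 0 < 1 - γ := by linarith
  unfold absorbR
  split_ifs
  · exact ⟨mul_nonneg hg.le hu.1, by have := (le_div_iff₀ hg).1 hu.2; linarith⟩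
  · exact hR s h

variable [Fintype S]

lemma absorbP_mem (hP : ∀ s h, P s h ∈ stdSimplex ℝ S) (s₀ s : S) (h : G) :
    absorbP P s₀ s h ∈ stdSimplex ℝ S := by
  unfold absorbP
  split_ifs
  · exact single_mem_stdSimplex ℝ s₀
  · exact hP s h

variable [Fintype G] [Nonempty G]

/-- Absorbing a state at a value close to its optimal value hardly changes the optimal values. -/
lemma abs_optVal_sub_absorb_le (hP : ∀ s h, P s h ∈ stdSimplex ℝ S) (h0 : 0 ≤ γ) (h1 : γ < 1)
    (s₀ : S) (u : ℝ) (s : S) :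
    |optVal P R γ s - optVal (absorbP P s₀) (absorbR R γ s₀ u) γ s| ≤ |optVal P R γ s₀ - u| := by
  have hg : 0 < 1 - γ := by linarith
  -- The original optimum solves the absorbed Bellman equation away from `s₀` and misses it by `(1 -
  -- γ) * |optVal P R γ s₀ - u|` at `s₀`. The factor `1 - γ` cancels the loss in
  -- `abs_sub_optVal_le`.
  have h := abs_sub_optVal_le (P := absorbP P s₀) (R := absorbR R γ s₀ u) (absorbP_mem hP s₀) h0 h1
    (W := optVal P R γ) (c := (1 - γ) * |optVal P R γ s₀ - u|) (fun s => by
      by_cases hs : s = s₀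
      · subst hs
        have : bellman (absorbP P s) (absorbR R γ s u) γ (optVal P R γ) s
            = (1 - γ) * u + γ * optVal P R γ s := by
          simp [bellman, absorbP, absorbR, Pi.single_apply]
        rw [this, show (1 - γ) * u + γ * optVal P R γ s - optVal P R γ s
          = (1 - γ) * -(optVal P R γ s - u) by ring, abs_mul, abs_neg, abs_of_pos hg]
      · have : bellman (absorbP P s₀) (absorbR R γ s₀ u) γ (optVal P R γ) s
            = optVal P R γ s := by
          conv_rhs => rw [← bellman_optVal hP h0 h1]
          simp [bellman, absorbP, absorbR, hs]
        rw [this, sub_self, abs_zero]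
        positivity) s
  rwa [mul_div_cancel_left₀ _ hg.ne'] at h

end Absorbing

/-! ### Finite grids of values for the absorbed state -/

section Net

/-- The `j`-th point of a grid of mesh `η` around `v`, projected to `[0, b]`. -/
def gridPoint (v η b : ℝ) (q : ℕ) (j : Fin (2 * q + 1)) : ℝ :=
  max 0 (min b (v + ((j : ℕ) - q) * η))

lemma gridPoint_mem_Icc {b : ℝ} (hb : 0 ≤ b) (v η : ℝ) (q : ℕ) (j : Fin (2 * q + 1)) :
    gridPoint v η b q j ∈ Set.Icc 0 b :=
  ⟨le_max_left _ _, max_le hb (min_le_left _ _)⟩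

/-- Round `(w - v) / η + q` down; clamping to `[0, b]` does not increase the distance to a point of
that interval. -/
lemma exists_gridPoint_near {v η b w : ℝ} {q : ℕ} (hη : 0 ≤ η) (hw : w ∈ Set.Icc 0 b)
    (h : |w - v| ≤ q * η) : ∃ j, |w - gridPoint v η b q j| ≤ η := by
  have key : ∃ j : Fin (2 * q + 1), |w - (v + ((j : ℕ) - q) * η)| ≤ η := by
    rcases hη.eq_or_lt with h0 | h0
    · subst h0
      refine ⟨0, ?_⟩
      simpa using h
    · have h1 := abs_le.1 h
      have hx : 0 ≤ (w - v) / η + q := by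
        have : -(q : ℝ) ≤ (w - v) / η := by rw [le_div_iff₀ h0]; linarith
        linarith
      have hx' : (w - v) / η + q ≤ 2 * q := by
        have : (w - v) / η ≤ q := by rw [div_le_iff₀ h0]; linarith
        linarith
      have hfl := Nat.floor_le hx
      have hfl' := Nat.lt_floor_add_one ((w - v) / η + q)
      refine ⟨⟨⌊(w - v) / η + q⌋₊, Nat.lt_succ_of_le (Nat.floor_le_of_le (by simpa using hx'))⟩, ?_⟩
      have e : w - (v + (((⌊(w - v) / η + q⌋₊ : ℕ) : ℝ) - q) * η)
          = ((w - v) / η + q - (⌊(w - v) / η + q⌋₊ : ℕ)) * η := by field_simp; ring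
      rw [e, abs_mul, abs_of_pos h0]
      refine mul_le_of_le_one_left h0.le (abs_le.2 ⟨by linarith, by linarith⟩)
  obtain ⟨j, hj⟩ := key
  refine ⟨j, le_trans ?_ hj⟩
  obtain ⟨hw0, hw1⟩ := hw
  unfold gridPoint
  set x := v + ((j : ℕ) - q) * η
  rcases max_cases 0 (min b x) with ⟨h1, h2⟩ | ⟨h1, h2⟩ <;>
  rcases min_cases b x with ⟨h3, h4⟩ | ⟨h3, h4⟩ <;>
  rw [h1] <;> (try rw [h3]) <;> (try rw [h3] at h2) <;> rw [abs_le] <;>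
  constructor <;> linarith [abs_le.1 (le_refl |w - x|)]

end Net

/-! ### From test functions to the empirical optimal value -/

section LeaveOneOut

variable {S G : Type*} [Fintype S] [DecidableEq S] [Fintype G] [Nonempty G]
  {P P' : S → G → S → ℝ} {R : S → G → ℝ} {γ : ℝ}

/-- The test functions at `s`: the optimal value of the true model and the optimal values of
the approximate model `P'` with `s` absorbing at the points of a grid. -/
def testFun (P P' : S → G → S → ℝ) (R : S → G → ℝ) (γ η : ℝ) (q : ℕ) (s : S) :
    Option (Fin (2 * q + 1)) → S → ℝ
  | none => optVal P R γ
  | some j => optVal (absorbP P' s)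
      (absorbR R γ s (gridPoint (optVal P R γ s) η (1 / (1 - γ)) q j)) γ

lemma testFun_mem_Icc (hP : ∀ s h, P s h ∈ stdSimplex ℝ S) (hP' : ∀ s h, P' s h ∈ stdSimplex ℝ S)
    (hR : ∀ s h, R s h ∈ Set.Icc 0 1) (h0 : 0 ≤ γ) (h1 : γ < 1) (η : ℝ) (q : ℕ) (s : S)
    (o : Option (Fin (2 * q + 1))) (s' : S) :
    testFun P P' R γ η q s o s' ∈ Set.Icc 0 (1 / (1 - γ)) := by
  have hg : 0 < 1 - γ := by linarith
  cases o with
  | none => exact optVal_mem_Icc hP hR h0 h1 s'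
  | some j =>
    exact optVal_mem_Icc (absorbP_mem hP' s)
      (absorbR_mem_Icc hR h1 (gridPoint_mem_Icc (by positivity) _ _ _ _)) h0 h1 s'

/-- Bernstein-type deviation bounds on all test functions imply such a bound on the optimal value
of the approximate model. -/
lemma deviation_of_testFun (hP : ∀ s h, P s h ∈ stdSimplex ℝ S)
    (hP' : ∀ s h, P' s h ∈ stdSimplex ℝ S) (hR : ∀ s h, R s h ∈ Set.Icc 0 1)
    (h0 : 0 ≤ γ) (h1 : γ < 1) {κ : ℝ} (hκ : 0 ≤ κ) (hκ' : 9 * κ ≤ 1 - γ) {q : ℕ}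
    (hq : 3 / (1 - γ) ^ 2 ≤ q)
    (hdev : ∀ s h o, |∑ s', P' s h s' * testFun P P' R γ (κ / 2) q s o s'
      - ∑ s', P s h s' * testFun P P' R γ (κ / 2) q s o s'|
      ≤ κ * √(wvar (P s h) (testFun P P' R γ (κ / 2) q s o)) + 1 / (1 - γ) * (κ ^ 2 / 4))
    (s : S) (h : G) :
    |∑ s', P' s h s' * optVal P' R γ s' - ∑ s', P s h s' * optVal P' R γ s'|
      ≤ κ * √(wvar (P s h) (optVal P' R γ)) + 5 / 4 * κ := by
  have hg : 0 < 1 - γ := by linarith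
  have hg1 : 1 - γ ≤ 1 := by linarith
  have hsq : 1 / (1 - γ) * (κ ^ 2 / 4) ≤ κ / 36 := by
    rw [div_mul_eq_mul_div, one_mul, div_le_iff₀ hg]
    nlinarith [mul_le_mul_of_nonneg_left hκ' hκ]
  have hb : 1 ≤ 1 / (1 - γ) := by rw [le_div_iff₀ hg]; linarith
  have hVI := optVal_mem_Icc hP hR h0 h1
  -- The deviation on the sample-independent test function `none` already confines the empirical
  -- optimum to a window around the true one. Its width is proportional to `κ`, so a number `q` of
  -- grid steps independent of `κ` covers it.
  have hcrude : ∀ s, |optVal P R γ s - optVal P' R γ s| ≤ q * (κ / 2) := by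
    intro s
    have h2 := abs_sub_optVal_le (P := P') (R := R) hP' h0 h1 (W := optVal P R γ)
      (c := 3 / 2 * κ / (1 - γ)) (fun s => by
        have h3 : bellman P' R γ (optVal P R γ) s - optVal P R γ s
            = bellman P' R γ (optVal P R γ) s - bellman P R γ (optVal P R γ) s := by
          rw [bellman_optVal hP h0 h1]
        rw [h3]
        refine abs_bellman_sub_le fun h => ?_
        rw [add_sub_add_left_eq_sub, ← mul_sub, abs_mul, abs_of_nonneg h0]
        have h4 := hdev s h none
        simp only [testFun] at h4
        have h5 : √(wvar (P s h) (optVal P R γ)) ≤ 1 / (1 - γ) := by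
          refine Real.sqrt_le_iff.2 ⟨by positivity, wvar_le_sq (hP s h) fun s' => ?_⟩
          rw [abs_of_nonneg (hVI s').1]
          exact (hVI s').2
        have h6 := mul_le_mul_of_nonneg_left h5 hκ
        have h7 : κ ≤ κ * (1 / (1 - γ)) := le_mul_of_one_le_right hκ hb
        have h8 : 3 / 2 * κ / (1 - γ) = 3 / 2 * (κ * (1 / (1 - γ))) := by ring
        rw [h8]
        refine (mul_le_of_le_one_left (abs_nonneg _) h1.le).trans (h4.trans ?_)
        linarith) s
    refine h2.trans ?_
    have := mul_le_mul_of_nonneg_right hq (show 0 ≤ κ / 2 by positivity)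
    refine le_trans (le_of_eq ?_) this
    field_simp
  obtain ⟨j, hj⟩ := exists_gridPoint_near (η := κ / 2) (by positivity)
    (optVal_mem_Icc hP' hR h0 h1 s) (by rw [abs_sub_comm]; exact hcrude s)
  have hclose : ∀ s', |optVal P' R γ s' - testFun P P' R γ (κ / 2) q s (some j) s'| ≤ κ / 2 :=
    fun s' => (abs_optVal_sub_absorb_le hP' h0 h1 s _ s').trans hj
  have h2 := hdev s h (some j)
  set f := testFun P P' R γ (κ / 2) q s (some j)
  set U := optVal P' R γ
  have h3 : √(wvar (P s h) f) ≤ √(wvar (P s h) U) + κ / 2 :=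
    sqrt_wvar_le (hP s h) (by positivity) fun s' => by rw [abs_sub_comm]; exact hclose s'
  have h4 := abs_le.1 (abs_sum_mul_le (hP s h) hclose)
  have h5 := abs_le.1 (abs_sum_mul_le (hP' s h) hclose)
  have h6 := abs_le.1 h2
  have h7 := mul_le_mul_of_nonneg_left h3 hκ
  simp only [mul_sub, Finset.sum_sub_distrib] at h4 h5
  -- Replacing `f` by `U` costs `κ / 2` in each mean and `κ ^ 2 / 2` in the deviation; with `hsq`
  -- the total is `κ * (1 + 1 / 18 + 1 / 36) ≤ 5 / 4 * κ`.
  have h8 : κ * (κ / 2) ≤ κ / 18 := by nlinarith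
  rw [abs_le]
  constructor <;> linarith

end LeaveOneOut

/-! ### Union bound over states, groups and test functions -/

section SampleComplexity

variable {S G Ω : Type*} [Fintype S] [DecidableEq S] [MeasurableSpace S]
  [MeasurableSingletonClass S] [Fintype G] [Nonempty G] [Nonempty S]
  [MeasurableSpace Ω] {μ : Measure Ω} [IsProbabilityMeasure μ] {m : ℕ}

/-- With high probability, the empirical model deviates little from the true one on its own
optimal value function. -/
theorem one_sub_le_measureReal_deviation (hm : 0 < m) {X : S × G × Fin m → Ω → S}
    (hX : ∀ i, Measurable (X i)) (hind : iIndepFun X μ) {P : S → G → S → ℝ}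
    (hP : ∀ s h, P s h ∈ stdSimplex ℝ S)
    (hlaw : ∀ s h k s', μ.real {ω | X (s, h, k) ω = s'} = P s h s') {R : S → G → ℝ}
    (hR : ∀ s h, R s h ∈ Set.Icc 0 1) {γ : ℝ} (h0 : 0 ≤ γ) (h1 : γ < 1) {t : ℝ} (ht : 0 ≤ t)
    (hκ' : 9 * (2 * √(t / m)) ≤ 1 - γ) :
    1 - 20 * (Fintype.card S * Fintype.card G) / (1 - γ) ^ 2 * Real.exp (-t)
      ≤ μ.real {ω | ∀ s h,
        |∑ s', empP (fun i => X i ω) s h s' * optVal (empP fun i => X i ω) R γ s'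
          - ∑ s', P s h s' * optVal (empP fun i => X i ω) R γ s'|
        ≤ 2 * √(t / m) * √(wvar (P s h) (optVal (empP fun i => X i ω) R γ))
          + 5 / 4 * (2 * √(t / m))} := by
  have hg : 0 < 1 - γ := by linarith
  set κ := 2 * √(t / m) with hκdef
  have hκ : 0 ≤ κ := by positivity
  have hκ4 : κ ^ 2 / 4 = t / m := by
    rw [hκdef, mul_pow, Real.sq_sqrt (by positivity)]; ring
  set q := ⌈3 / (1 - γ) ^ 2⌉₊ with hqdef
  have hq : 3 / (1 - γ) ^ 2 ≤ q := Nat.le_ceil _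
  have hq' : (q : ℝ) < 3 / (1 - γ) ^ 2 + 1 := Nat.ceil_lt_add_one (by positivity)
  set bad : S × G × Option (Fin (2 * q + 1)) → Set Ω := fun i =>
    {ω | κ * √(wvar (P i.1 i.2.1) (testFun P (empP fun i => X i ω) R γ (κ / 2) q i.1 i.2.2))
        + 1 / (1 - γ) * (t / m)
      < |∑ s', empP (fun i => X i ω) i.1 i.2.1 s'
            * testFun P (empP fun i => X i ω) R γ (κ / 2) q i.1 i.2.2 s'
          - ∑ s', P i.1 i.2.1 s'
            * testFun P (empP fun i => X i ω) R γ (κ / 2) q i.1 i.2.2 s'|} with hbad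
  have hbadle : ∀ i, μ.real (bad i) ≤ 2 * Real.exp (-t) := by
    rintro ⟨s, h, o⟩
    refine bernstein_empP hm hX hind hP hlaw s h
      (Φ := fun x => testFun P (empP x) R γ (κ / 2) q s o) (by positivity) ht
      (fun x s' => testFun_mem_Icc hP (empP_mem hm x) hR h0 h1 _ _ _ _ _) fun x x' hx => ?_
    -- The true optimum involves no samples, and absorption overwrites the row of `s`; either way
    -- the samples at `s` play no role.
    cases o with
    | none => rfl
    | some j =>
      simp only [testFun]
      rw [absorbP_congr (P := empP x) (P' := empP x') fun s' hs' => ?_]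
      funext h' s''
      simp only [empP]
      rw [Finset.filter_congr fun k _ => by rw [hx (s', h', k) hs']]
  set good := {ω | ∀ s h,
        |∑ s', empP (fun i => X i ω) s h s' * optVal (empP fun i => X i ω) R γ s'
          - ∑ s', P s h s' * optVal (empP fun i => X i ω) R γ s'|
        ≤ κ * √(wvar (P s h) (optVal (empP fun i => X i ω) R γ)) + 5 / 4 * κ} with hgood
  -- A cover of the whole space, rather than a complement, makes measurability of `good`
  -- unnecessary.
  have hcover : Set.univ ⊆ good ∪ ⋃ i, bad i := by
    intro ω _
    by_cases hω : ω ∈ ⋃ i, bad i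
    · exact Or.inr hω
    · refine Or.inl (deviation_of_testFun hP (empP_mem hm _) hR h0 h1 hκ hκ' hq fun s h o => ?_)
      rw [hκ4]
      exact not_lt.1 fun hlt => hω (Set.mem_iUnion.2 ⟨(s, h, o), hlt⟩)
  have hsum : μ.real (⋃ i, bad i)
      ≤ 20 * (Fintype.card S * Fintype.card G) / (1 - γ) ^ 2 * Real.exp (-t) := by
    refine (measureReal_iUnion_fintype_le _).trans
      ((Finset.sum_le_sum fun i _ => hbadle i).trans ?_)
    rw [Finset.sum_const, Finset.card_univ, nsmul_eq_mul, ← mul_assoc]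
    refine mul_le_mul_of_nonneg_right ?_ (Real.exp_nonneg _)
    simp only [Fintype.card_prod, Fintype.card_option, Fintype.card_fin]
    push_cast
    have h3 : 1 ≤ 1 / (1 - γ) ^ 2 := by
      rw [le_div_iff₀ (by positivity)]
      nlinarith
    have h4 : 2 * (q : ℝ) + 1 + 1 ≤ 10 * (1 / (1 - γ) ^ 2) := by
      have : 3 / (1 - γ) ^ 2 = 3 * (1 / (1 - γ) ^ 2) := by ring
      linarith
    calc _ = 2 * ((Fintype.card S : ℝ) * Fintype.card G) * (2 * (q : ℝ) + 1 + 1) := by ring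
      _ ≤ 2 * ((Fintype.card S : ℝ) * Fintype.card G) * (10 * (1 / (1 - γ) ^ 2)) :=
          mul_le_mul_of_nonneg_left h4 (by positivity)
      _ = _ := by ring
  have h2 : 1 ≤ μ.real good + μ.real (⋃ i, bad i) := by
    rw [← probReal_univ (μ := μ)]
    exact (measureReal_mono hcover).trans (measureReal_union_le _ _)
  linarith

end SampleComplexity

/-! ### Loss of optimality caused by grouping -/

section Overlap

variable {S A G : Type*} [Fintype S]

/-- The overlap of the transition probabilities of a group. -/
def overlap (M : MDP S A) (g : A → G) (s : S) (h : G) (s' : S) : ℝ :=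
  ⨅ a : {a : A // g a = h}, M.P s a s'

lemma one_sub_sum_overlap_le [Fintype G] (M : MDP S A) (g : A → G) (s : S) (h : G) :
    1 - ∑ s', overlap M g s h s' ≤ betaP M g :=
  sub_le_sub_left (ciInf_le (f := fun p : S × G => ∑ s', overlap M g p.1 p.2 s')
    (Set.finite_range _).bddBelow (s, h)) 1

end Overlap

section GroupingLoss

variable {S A G : Type*} [Fintype S] [Fintype A] {M : MDP S A} {g : A → G}

lemma groupP_mem (M : MDP S A) (πi : LowerPolicy g) (s : S) (h : G) :
    groupP M πi s h ∈ stdSimplex ℝ S := by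
  refine ⟨fun s' => Finset.sum_nonneg fun a _ =>
    mul_nonneg ((πi.prob_mem h).1 a) ((M.P_mem s a).1 s'), ?_⟩
  simp only [groupP]
  rw [Finset.sum_comm]
  simp only [← Finset.mul_sum, (M.P_mem _ _).2, mul_one, (πi.prob_mem h).2]

lemma groupR_mem_Icc (hR : ∀ s a, 0 ≤ M.R s a ∧ M.R s a ≤ 1) (πi : LowerPolicy g) (s : S) (h : G) :
    groupR M πi s h ∈ Set.Icc 0 1 :=
  sum_mul_mem_Icc (πi.prob_mem h) fun a => hR s a

lemma sum_groupP_mul (πi : LowerPolicy g) (s : S) (h : G) (f : S → ℝ) :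
    ∑ s', groupP M πi s h s' * f s' = ∑ a, πi.prob h a * ∑ s', M.P s a s' * f s' := by
  simp only [groupP, Finset.sum_mul, Finset.mul_sum, mul_assoc]
  exact Finset.sum_comm

lemma le_sum_prob_mul (πi : LowerPolicy g) (h : G) {f : A → ℝ} {c : ℝ}
    (hf : ∀ a, g a = h → c ≤ f a) : c ≤ ∑ a, πi.prob h a * f a := by
  rw [← sum_mul_const (πi.prob_mem h) c]
  refine Finset.sum_le_sum fun a _ => ?_
  by_cases ha : g a = h
  · exact mul_le_mul_of_nonneg_left (hf a ha) ((πi.prob_mem h).1 a)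
  · rw [πi.prob_supp h a ha, zero_mul, zero_mul]

lemma sub_le_betaR (M : MDP S A) {s : S} {a a' : A} (h : g a = g a') :
    M.R s a - M.R s a' ≤ betaR M g :=
  le_ciSup (f := fun p : {p : S × A × A // g p.2.1 = g p.2.2} =>
    M.R p.1.1 p.1.2.1 - M.R p.1.1 p.1.2.2) (Set.finite_range _).bddAbove ⟨(s, a, a'), h⟩

lemma R_le_groupR_add (πi : LowerPolicy g) (s : S) (a : A) :
    M.R s a ≤ groupR M πi s (g a) + betaR M g := by
  have := le_sum_prob_mul πi (g a) (f := M.R s) (c := M.R s a - betaR M g)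
    fun a' ha' => by linarith [sub_le_betaR M (s := s) ha'.symm]
  unfold groupR
  linarith

lemma overlap_le (M : MDP S A) (g : A → G) (s : S) (a : A) (s' : S) :
    overlap M g s (g a) s' ≤ M.P s a s' :=
  ciInf_le (f := fun b : {b : A // g b = g a} => M.P s b s')
    (Set.finite_range _).bddBelow ⟨a, rfl⟩

lemma betaP_nonneg [Fintype G] [Nonempty S] [Nonempty A] (M : MDP S A) (g : A → G) :
    0 ≤ betaP M g := by
  obtain ⟨s⟩ := ‹Nonempty S›
  obtain ⟨a⟩ := ‹Nonempty A›
  refine le_trans ?_ (one_sub_sum_overlap_le M g s (g a))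
  rw [← (M.P_mem s a).2, sub_nonneg]
  exact Finset.sum_le_sum fun s' _ => overlap_le M g s a s'

lemma betaR_nonneg [Nonempty S] [Nonempty A] (M : MDP S A) (g : A → G) : 0 ≤ betaR M g := by
  obtain ⟨s⟩ := ‹Nonempty S›
  obtain ⟨a⟩ := ‹Nonempty A›
  simpa using sub_le_betaR M (s := s) (rfl : g a = g a)

/-- Both distributions dominate the overlap of the group. The mass of `M.P s a` beyond the overlap
is at most `β_P` and is paid at `f ≤ b`; the excess mass of `groupP` is dropped because `f ≥ 0`. -/
lemma sum_P_mul_le_groupP_add [Fintype G] (πi : LowerPolicy g) (s : S) (a : A) {f : S → ℝ} {b : ℝ}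
    (hb : 0 ≤ b) (hf : ∀ s, f s ∈ Set.Icc 0 b) :
    ∑ s', M.P s a s' * f s' ≤ ∑ s', groupP M πi s (g a) s' * f s' + betaP M g * b := by
  set o := overlap M g s (g a)
  have h1 : ∑ s', (M.P s a s' - o s') * f s' ≤ ∑ s', (M.P s a s' - o s') * b :=
    Finset.sum_le_sum fun s' _ => mul_le_mul_of_nonneg_left (hf s').2
      (sub_nonneg.2 (overlap_le M g s a s'))
  have h2 : ∑ s', o s' * f s' ≤ ∑ s', groupP M πi s (g a) s' * f s' :=
    Finset.sum_le_sum fun s' _ => mul_le_mul_of_nonneg_right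
      (le_sum_prob_mul πi (g a) fun a' ha' => by
        have := overlap_le M g s a' s'
        rwa [ha'] at this) (hf s').1
  have h3 := mul_le_mul_of_nonneg_right (one_sub_sum_overlap_le M g s (g a)) hb
  rw [← Finset.sum_mul, Finset.sum_sub_distrib, (M.P_mem s a).2] at h1
  simp only [sub_mul, Finset.sum_sub_distrib] at h1 h3
  linarith

lemma empR_eq {m : ℕ} (hm : 0 < m) (πi : LowerPolicy g) : empR M πi m = groupR M πi := by
  have hm' : (m : ℝ) ≠ 0 := Nat.cast_ne_zero.2 hm.ne'
  funext s h
  simp only [empR, Finset.sum_const, Finset.card_univ, Fintype.card_fin, nsmul_eq_mul]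
  exact mul_div_cancel_left₀ _ hm'

variable [Fintype G] [MeasurableSpace S] [MeasurableSingletonClass S] [MeasurableSpace A]
  [MeasurableSingletonClass A]

/-- Restricting to grouped actions loses at most `β_R / (1 - γ) + γ β_P / (1 - γ)²`. -/
lemma V_le_optVal_group_add [Nonempty G] (hR : ∀ s a, 0 ≤ M.R s a ∧ M.R s a ≤ 1)
    (πi : LowerPolicy g) (π : Policy S A) (s : S) :
    M.V π s ≤ optVal (groupP M πi) (groupR M πi) M.γ s
      + (betaR M g / (1 - M.γ) + M.γ * betaP M g / (1 - M.γ) ^ 2) := by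
  have h0 := M.γ_nonneg
  have h1 := M.γ_lt_one
  have hg : 0 < 1 - M.γ := by linarith
  have hP := groupP_mem M πi
  have hRG := groupR_mem_Icc hR πi
  set U := optVal (groupP M πi) (groupR M πi) M.γ with hU
  have hUI : ∀ s, U s ∈ Set.Icc 0 (1 / (1 - M.γ)) := optVal_mem_Icc hP hRG h0 h1
  -- The maximum principle along the state chain induced by `π`.
  have key := le_div_of_le_add_average h0 h1 (x := fun s => M.V π s - U s)
    (c := betaR M g + M.γ * (betaP M g * (1 / (1 - M.γ)))) (fun s => by
      refine ⟨fun s' => ∑ a, π s a * M.P s a s', ⟨fun s' => Finset.sum_nonneg fun a _ =>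
        mul_nonneg ((π s).2.1 a) ((M.P_mem s a).1 s'), ?_⟩, ?_⟩
      · rw [Finset.sum_comm]
        simp only [← Finset.mul_sum, (M.P_mem _ _).2, mul_one, stdSimplex.sum_eq_one]
      · have h2 : ∀ a, M.R s a + M.γ * ∑ s', M.P s a s' * U s'
            ≤ U s + (betaR M g + M.γ * (betaP M g * (1 / (1 - M.γ)))) := by
          intro a
          have h3 := R_le_groupR_add (M := M) πi s a
          have h4 := mul_le_mul_of_nonneg_left
            (sum_P_mul_le_groupP_add (M := M) πi s a (by positivity) hUI) h0
          have h5 := le_optVal (R := groupR M πi) hP h0 h1 s (g a)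
          rw [← hU] at h5
          linarith
        have h3 := sum_mul_mono (π s).2 h2
        rw [sum_mul_const (π s).2] at h3
        have h4 : ∑ s', (∑ a, π s a * M.P s a s') * (M.V π s' - U s')
            = ∑ a, π s a * ∑ s', M.P s a s' * (M.V π s' - U s') := by
          simp only [Finset.sum_mul, Finset.mul_sum, mul_assoc]
          exact Finset.sum_comm
        have h5 : M.V π s = ∑ a, π s a * (M.R s a + M.γ * ∑ s', M.P s a s' * U s')
            + M.γ * ∑ a, π s a * ∑ s', M.P s a s' * (M.V π s' - U s') := by
          rw [V_eq hR, Finset.mul_sum, ← Finset.sum_add_distrib]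
          refine Finset.sum_congr rfl fun a _ => ?_
          simp only [mul_sub, Finset.sum_sub_distrib]
          ring
        rw [h4]
        have h6 : ∑ a, π s a * (M.R s a + M.γ * ∑ s', M.P s a s' * U s')
            ≤ U s + (betaR M g + M.γ * (betaP M g * (1 / (1 - M.γ)))) := h3
        linarith) s
  have e : (betaR M g + M.γ * (betaP M g * (1 / (1 - M.γ)))) / (1 - M.γ)
      = betaR M g / (1 - M.γ) + M.γ * betaP M g / (1 - M.γ) ^ 2 := by field_simp
  rw [e] at key
  linarith

/-- Bellman equation of a hierarchical policy in the grouped model. -/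
lemma V_joint_pointPolicy [DecidableEq G] (hR : ∀ s a, 0 ≤ M.R s a ∧ M.R s a ≤ 1)
    (πi : LowerPolicy g) (ρ : S → G) (s : S) :
    M.V (joint (pointPolicy ρ) πi) s = groupR M πi s (ρ s)
      + M.γ * ∑ s', groupP M πi s (ρ s) s' * M.V (joint (pointPolicy ρ) πi) s' := by
  have hj : ∀ a, joint (pointPolicy ρ) πi s a = πi.prob (ρ s) a := by
    intro a
    change (Pi.single (ρ s) 1 : G → ℝ) (g a) * πi.prob (g a) a = _
    by_cases ha : g a = ρ s
    · rw [ha, Pi.single_eq_same, one_mul]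
    · rw [Pi.single_eq_of_ne ha, zero_mul, πi.prob_supp _ a ha]
  rw [V_eq hR, sum_groupP_mul, groupR, Finset.mul_sum, ← Finset.sum_add_distrib]
  refine Finset.sum_congr rfl fun a _ => ?_
  rw [hj]
  ring

/-- Only one copy of the grouping loss is incurred; the second is slack from its nonnegativity. The
uniform bound over policies also makes the supremum `Vopt` finite. -/
lemma norm_Vopt_sub_le [Nonempty S] [Nonempty A] [Nonempty G] [DecidableEq G]
    (hR : ∀ s a, 0 ≤ M.R s a ∧ M.R s a ≤ 1) (πi : LowerPolicy g) (ρ : S → G) {c : ℝ} (hc : 0 ≤ c)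
    (h : ∀ s, optVal (groupP M πi) (groupR M πi) M.γ s
      - M.V (joint (pointPolicy ρ) πi) s ≤ c) :
    ‖M.Vopt - M.V (joint (pointPolicy ρ) πi)‖
      ≤ 2 * (betaR M g / (1 - M.γ) + M.γ * betaP M g / (1 - M.γ) ^ 2) + c := by
  have hg : 0 < 1 - M.γ := by linarith [M.γ_lt_one]
  have hβ : 0 ≤ betaR M g / (1 - M.γ) + M.γ * betaP M g / (1 - M.γ) ^ 2 := by
    have h0 := M.γ_nonneg
    have h1 := betaR_nonneg M g
    have h2 := betaP_nonneg M g
    positivity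
  have hub := V_le_optVal_group_add hR πi
  have : Nonempty (Policy S A) := ⟨joint (pointPolicy ρ) πi⟩
  refine (pi_norm_le_iff_of_nonneg (by positivity)).2 fun s => ?_
  have h1 : M.Vopt s ≤ optVal (groupP M πi) (groupR M πi) M.γ s
      + (betaR M g / (1 - M.γ) + M.γ * betaP M g / (1 - M.γ) ^ 2) := ciSup_le fun π => hub π s
  have h2 : M.V (joint (pointPolicy ρ) πi) s ≤ M.Vopt s :=
    le_ciSup (f := fun π => M.V π s) ⟨_, by rintro _ ⟨π, rfl⟩; exact hub π s⟩ _
  rw [Pi.sub_apply, Real.norm_eq_abs, abs_of_nonneg (sub_nonneg.2 h2)]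
  linarith [h s]

end GroupingLoss

/-! ### Numerical constants -/

section Constants

lemma deviation_constants_le {γ L m x : ℝ} (h0 : 0 ≤ γ) (h1 : γ < 1) (hL : 0 ≤ L) (hm : 0 < m)
    (hx : 0 ≤ x) :
    9 / 4 * (γ * (2 * √(2 * L / m) * (√(2 / (1 - γ)) / (1 - γ)))
        + (γ * (5 / 4 * (2 * √(2 * L / m))) + x / (1 - γ)) / (1 - γ))
      ≤ 20 * γ * √(L / (m * (1 - γ) ^ 3)) + 8 * x / (1 - γ) ^ 3 := by
  have hg : 0 < 1 - γ := by linarith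
  set W := √(L / (m * (1 - γ) ^ 3)) with hW
  have hW0 : 0 ≤ W := Real.sqrt_nonneg _
  have e1 : 2 * √(2 * L / m) * (√(2 / (1 - γ)) / (1 - γ)) = 4 * W := by
    have : √(2 * L / m) * √(2 / (1 - γ)) = 2 * (W * (1 - γ)) := by
      rw [← Real.sqrt_mul (by positivity)]
      conv_rhs => rw [hW, ← Real.sqrt_sq hg.le, ← Real.sqrt_mul (by positivity),
        ← Real.sqrt_sq (show (0 : ℝ) ≤ 2 by norm_num), ← Real.sqrt_mul (by positivity)]
      congr 1
      rw [Real.sqrt_sq hg.le]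
      field_simp
    calc _ = 2 * (√(2 * L / m) * √(2 / (1 - γ))) / (1 - γ) := by ring
      _ = _ := by rw [this]; field_simp; ring
  -- The lower-order term lacks the factor `√(2 / (1 - γ))`; since that factor is at least `√2`,
  -- inserting it costs at most `5 / 7`. The coefficient becomes `9 / 4 * (4 + 25 / 7) < 20`.
  have h2 : 7 / 5 ≤ √(2 / (1 - γ)) := by
    refine Real.le_sqrt_of_sq_le ?_
    rw [le_div_iff₀ hg]
    nlinarith
  have e2 : 2 * √(2 * L / m) / (1 - γ) * (7 / 5) ≤ 4 * W := by
    rw [← e1]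
    calc _ ≤ 2 * √(2 * L / m) / (1 - γ) * √(2 / (1 - γ)) :=
          mul_le_mul_of_nonneg_left h2 (by positivity)
      _ = _ := by ring
  rw [e1]
  have e3 : (γ * (5 / 4 * (2 * √(2 * L / m))) + x / (1 - γ)) / (1 - γ)
      = 5 / 4 * (γ * (2 * √(2 * L / m) / (1 - γ))) + x / (1 - γ) ^ 2 := by
    field_simp
  rw [e3]
  have h3 := mul_le_mul_of_nonneg_left e2 h0
  have h4 : x / (1 - γ) ^ 2 ≤ x / (1 - γ) ^ 3 := by
    refine div_le_div_of_nonneg_left hx (by positivity) ?_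
    exact pow_le_pow_of_le_one hg.le (by linarith) (by norm_num)
  have h5 : 0 ≤ x / (1 - γ) ^ 3 := by positivity
  have h6 : 8 * x / (1 - γ) ^ 3 = 8 * (x / (1 - γ) ^ 3) := by ring
  have h7 : 0 ≤ γ * W := by positivity
  rw [h6]
  nlinarith

/-- The factor `2` before the logarithm squares its argument, which cancels `(1 - γ) ^ 2` and leaves
`20 * δ ^ 2 / (64 * n)`. -/
lemma failure_probability_lt {γ δ n : ℝ} (h1 : γ < 1) (hδ0 : 0 < δ) (hδ1 : δ < 1) (hn : 1 ≤ n) :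
    20 * n / (1 - γ) ^ 2 * Real.exp (-(2 * Real.log (8 * n / (δ * (1 - γ))))) < δ := by
  have hg : 0 < 1 - γ := by linarith
  have hn0 : 0 < n := by linarith
  have hpos : 0 < 8 * n / (δ * (1 - γ)) := by positivity
  have e : Real.exp (-(2 * Real.log (8 * n / (δ * (1 - γ)))))
      = ((8 * n / (δ * (1 - γ))) ^ 2)⁻¹ := by
    rw [Real.exp_neg, two_mul, Real.exp_add, Real.exp_log hpos, sq]
  have e2 : 20 * n / (1 - γ) ^ 2 * ((8 * n / (δ * (1 - γ))) ^ 2)⁻¹ = 20 * δ ^ 2 / (64 * n) := by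
    field_simp
    norm_num
  rw [e, e2, div_lt_iff₀ (by positivity)]
  nlinarith [mul_le_mul_of_nonneg_left hn hδ0.le]

end Constants

end

end GroupedMDP

/-! ### The main theorem -/

open GroupedMDP in
theorem corollary1 {S A G Ω : Type*}
    [Fintype S] [Nonempty S] [DecidableEq S] [MeasurableSpace S] [MeasurableSingletonClass S]
    [Fintype A] [Nonempty A] [MeasurableSpace A] [MeasurableSingletonClass A]
    [Fintype G] [DecidableEq G]
    -- the decision process, with rewards between 0 and 1
    (M : MDP S A) (hR : ∀ s a, 0 ≤ M.R s a ∧ M.R s a ≤ 1)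
    -- the grouping function and the lower-level policy
    (g : A → G) (hg : Function.Surjective g) (πi : LowerPolicy g)
    -- `m` draws per state-group pair, `K` draws in total, `T` iterations, confidence `δ`
    (m K T : ℕ) (hK : K = Fintype.card (S × G × Fin m))
    (δ : ℝ) (hδ0 : 0 < δ) (hδ1 : δ < 1)
    (hKlarge : 648 * Fintype.card S * Fintype.card G
      * Real.log (8 * Fintype.card S * Fintype.card G / (δ * (1 - M.γ))) / (1 - M.γ) ^ 2 ≤ (K : ℝ))
    -- the generative model: independent draws, `X (s, h, k)` having law `P_G(· | s, h)`
    [MeasurableSpace Ω] (μ : MeasureTheory.Measure Ω) [MeasureTheory.IsProbabilityMeasure μ]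
    (X : S × G × Fin m → Ω → S) (hX : ∀ i, Measurable (X i))
    (hind : ProbabilityTheory.iIndepFun X μ)
    (hlaw : ∀ s h k s', μ.real {ω | X (s, h, k) ω = s'} = groupP M πi s h s')
    -- arbitrary initial content of the policy register
    (ρ₀ : S → G) :
    -- on every sample, the program runs in exactly this number of steps ...
    (∀ ω, (runVI (empP fun i => X i ω) (empR M πi m) M.γ ρ₀ T).steps
        = (Fintype.card S ^ 2 * Fintype.card G + 2 * Fintype.card S * Fintype.card G) * T) ∧
    -- ... and outputs a greedy policy for the `T`-th value-iteration iterate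
    (∀ ω, IsGreedy (qIter (empP fun i => X i ω) (empR M πi m) M.γ T)
        (runVI (empP fun i => X i ω) (empR M πi m) M.γ ρ₀ T).policy) ∧
    -- with probability larger than `1 - δ`, however ties in the argmax are broken,
    -- the performance loss is bounded
    1 - δ < μ.real {ω | ∀ ρ : S → G,
      IsGreedy (qIter (empP fun i => X i ω) (empR M πi m) M.γ T) ρ →
        ‖M.Vopt - M.V (joint (pointPolicy ρ) πi)‖ ≤ epsPerf M g δ K T} := by
  have h0 := M.γ_nonneg
  have h1 := M.γ_lt_one
  have hg : 0 < 1 - M.γ := by linarith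
  have : Nonempty G := ⟨g (Classical.arbitrary A)⟩
  refine ⟨fun ω => runVI_steps _ _ _ _ _, fun ω => (isIterate_runVI ρ₀ T).greedy, ?_⟩
  have hS1 : (1 : ℝ) ≤ Fintype.card S := by exact_mod_cast Fintype.card_pos
  have hG1 : (1 : ℝ) ≤ Fintype.card G := by exact_mod_cast Fintype.card_pos
  have hn1 : (1 : ℝ) ≤ Fintype.card S * Fintype.card G := one_le_mul_of_one_le_of_one_le hS1 hG1
  have hKm : (K : ℝ) = Fintype.card S * Fintype.card G * m := by
    rw [hK]
    simp only [Fintype.card_prod, Fintype.card_fin]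
    push_cast
    ring
  unfold epsPerf
  simp only [mul_assoc (648 : ℝ), mul_assoc (8 : ℝ) (Fintype.card S : ℝ), hKm] at hKlarge ⊢
  set n : ℝ := Fintype.card S * Fintype.card G with hn
  set L := Real.log (8 * n / (δ * (1 - M.γ))) with hL
  have hn0 : 0 < n := by linarith
  have hL0 : 0 < L := by
    refine Real.log_pos ?_
    rw [lt_div_iff₀ (by positivity)]
    nlinarith [mul_pos hδ0 hg]
  have hmL : 648 * L / (1 - M.γ) ^ 2 ≤ m := by
    refine le_of_mul_le_mul_left ?_ hn0
    refine le_trans (le_of_eq ?_) hKlarge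
    ring
  have hm0 : (0 : ℝ) < m := lt_of_lt_of_le (by positivity) hmL
  have hm : 0 < m := Nat.cast_pos.1 hm0
  -- Here `648 = 2 * 18 ^ 2` is exactly what gives `√(2 * L / m) ≤ (1 - γ) / 18`.
  have hκ : 9 * (2 * √(2 * L / m)) ≤ 1 - M.γ := by
    have : √(2 * L / m) ≤ (1 - M.γ) / 18 := by
      rw [Real.sqrt_le_left (by positivity), div_le_iff₀ hm0]
      rw [div_le_iff₀ (by positivity)] at hmL
      linarith
    linarith
  have hRG := groupR_mem_Icc hR πi
  have hprob := one_sub_le_measureReal_deviation hm hX hind (groupP_mem M πi) hlaw hRG h0 h1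
    (t := 2 * L) (by positivity) hκ
  have hfail := failure_probability_lt h1 hδ0 hδ1 hn1
  -- The deviation event does not mention `ρ`, so on it the bound holds for all greedy policies at
  -- once.
  refine lt_of_lt_of_le (by linarith) (hprob.trans (measureReal_mono fun ω hω ρ hρ => ?_))
  rw [empR_eq hm] at hρ
  have hloss := optVal_sub_le_of_deviation (groupP_mem M πi) (empP_mem hm fun i => X i ω) hRG h0 h1
    (V_joint_pointPolicy hR πi ρ) (by positivity) hκ (by positivity)
    (show 0 ≤ M.γ ^ T / (1 - M.γ) by positivity) hω
    (optVal_le_of_isGreedy (empP_mem hm _) hRG h0 h1 hρ)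
  have hconst := deviation_constants_le h0 h1 hL0.le hm0 (pow_nonneg h0 T)
  rw [show n * L / (n * m * (1 - M.γ) ^ 3) = L / (m * (1 - M.γ) ^ 3) by
    rw [mul_assoc n m, mul_div_mul_left _ _ hn0.ne'], add_assoc]
  exact norm_Vopt_sub_le hR πi ρ (by positivity) fun s => (hloss s).trans hconst
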